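/- **Definitions.** A finite $d$-regular graph $G$ is an *$\epsilon$-expander* if $\lambda(G)\le(1-\epsilon)d$, where $\lambda(G)$ is the maximum absolute value of a non-trivial eigenvalue of the adjacency matrix of $G$ (all eigenvalues, with multiplicity, except one copy of $d$). An *$r$-uniform hypergraph* on a vertex set $V$ is a family of $r$-element subsets of $V$, called its $r$-edges; a *$k$-edge* is a $k$-element subset of an $r$-edge. For $1\le k\le r-1$, the *$k$-th order walk graph* $G^{(k)}_{\mathrm{walk}}(H)$ of an $r$-uniform hypergraph $H$ is the graph whose vertices are the $k$-edges of $H$, two different $k$-edges being adjacent if and only if they are contained in a common $(k+1)$-edge of $H$. For $r\ge 3$, let $[r]=\{1,\dots,r\}$ and let $\mathcal P$ be the family of all $I\subseteq[r]$ with $1\le|I|<r/2$, together with, if $r$ is even, all $I\subseteq[r]$ with $|I|=r/2$ and $1\in I$. For $S\subseteq\mathbb F_2^t$, let $\mathcal T$ be the set of tuples $\mathbf s=(s_I)_{I\in\mathcal P}$ of distinct elements of $S$, and for $x\in\mathbb F_2^t$ and $\mathbf s\in\mathcal T$ let $$e(x,\mathbf s)=\Big(x+\sum_{I\in\mathcal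 P,\ i\in I}s_I\Big)_{1\le i\le r}.$$ Let $\mathsf H_{r,t,S}$ be the $r$-uniform hypergraph with vertex set $\mathbb F_2^t$ in which $\{v_1,\dots,v_r\}$ is an $r$-edge if and only if $(v_1,\dots,v_r)=e(x,\mathbf s)$ for some $x\in\mathbb F_2^t$ and $\mathbf s\in\mathcal T$. **Theorem 2.** For every $r\ge 3$ there is a constant $c=c(r)>0$ such that the following holds. Let $t\in\mathbb N$, $\epsilon>0$ and $S\subseteq\mathbb F_2^t$ satisfy 1. $|S|\ge 2^{2r}$; 2. the sums $s_1+\cdots+s_l$ are different for all choices of $0\le l\le 2^r$ and of sets $\{s_1,\dots,s_l\}\subseteq S$ of $l$ distinct elements; 3. the Cayley graph $\mathrm{Cay}(\mathbb F_2^t,S)$ is an $\epsilon$-expander. Then, for every $1\le k\le r-1$, the $k$-th order walk graph $G^{(k)}_{\mathrm{walk}}(\mathsf H_{r,t,S})$ is a $c\epsilon$-expander. -/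

import Mathlib

/-! ### Spectral expansion of finite graphs -/

namespace SimpleGraph

open Classical in
/-- The non-trivial eigenvalues of the adjacency matrix of a finite regular graph: its eigenvalues
on the space of functions orthogonal to the constant functions. For a `d`-regular graph the adjacency
matrix preserves this space and maps the constant function `1` to `d • 1`, so these are all its
eigenvalues, counted with multiplicity, except for one copy of the trivial eigenvalue `d`. (In
particular `d` itself is non-trivial for a disconnected graph.) -/
def nontrivialEigenvalues {V : Type*} [Fintype V] (G : SimpleGraph V) : Set ℝ :=
  {μ | ∃ f : V → ℝ, f ≠ 0 ∧ ∑ v, f v = 0 ∧ (G.adjMatrix ℝ).mulVec f = μ • f}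

open Classical in
/-- A finite graph is an `ε`-expander if it is `d`-regular for some `d` and all its non-trivial
eigenvalues have absolute value at most `(1 - ε) d`. -/
def IsExpander {V : Type*} [Fintype V] (G : SimpleGraph V) (ε : ℝ) : Prop :=
  ∃ d : ℕ, G.IsRegularOfDegree d ∧ ∀ μ ∈ G.nontrivialEigenvalues, |μ| ≤ (1 - ε) * d

end SimpleGraph

/-! ### Uniform hypergraphs and their walk graphs -/

/-- An `r`-uniform hypergraph on the vertex set `V`: a family of `r`-element subsets of `V`. -/
structure UniformHypergraph (V : Type*) (r : ℕ) where
  /-- the `r`-edges -/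
  edges : Set (Finset V)
  /-- every edge has exactly `r` elements -/
  sized : edges.Sized r

namespace UniformHypergraph

/-- A `k`-edge of `H` is a `k`-element subset of an `r`-edge of `H`. -/
def IsKEdge {V : Type*} {r : ℕ} (H : UniformHypergraph V r) (k : ℕ) (a : Finset V) : Prop :=
  a.card = k ∧ ∃ b ∈ H.edges, a ⊆ b

/-- The type of `k`-edges of `H`. -/
def KEdge {V : Type*} {r : ℕ} (H : UniformHypergraph V r) (k : ℕ) : Type _ :=
  {a : Finset V // H.IsKEdge k a}

noncomputable instance {V : Type*} [Finite V] {r : ℕ} (H : UniformHypergraph V r) (k : ℕ) :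
    Fintype (H.KEdge k) :=
  haveI : Finite (H.KEdge k) := inferInstanceAs (Finite {a : Finset V // H.IsKEdge k a})
  Fintype.ofFinite _

/-- The `k`-th order walk graph of `H`: its vertices are the `k`-edges of `H`, and two different
`k`-edges are adjacent if and only if they are contained in a common `(k+1)`-edge of `H`. -/
def walkGraph {V : Type*} {r : ℕ} (H : UniformHypergraph V r) (k : ℕ) :
    SimpleGraph (H.KEdge k) where
  Adj a b := a ≠ b ∧ ∃ c : Finset V, H.IsKEdge (k + 1) c ∧ a.1 ⊆ c ∧ b.1 ⊆ c
  symm := ⟨fun _ _ h => ⟨h.1.symm, h.2.imp fun _ hc => ⟨hc.1, hc.2.2, hc.2.1⟩⟩⟩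
  loopless := ⟨fun _ h => h.1 rfl⟩

end UniformHypergraph

/-! ### The construction -/

namespace SumHypergraph

/-- The vector space `𝔽₂ᵗ`. -/
abbrev F2 (t : ℕ) : Type := Fin t → ZMod 2

/-- The sums of at most `n` distinct elements of `S` are pairwise different (the empty sum
included): a subset of `S` with at most `n` elements is determined by its sum. -/
def DistinctSums {t : ℕ} (S : Finset (F2 t)) (n : ℕ) : Prop :=
  ∀ A B : Finset (F2 t), A ⊆ S → B ⊆ S → A.card ≤ n → B.card ≤ n →
    ∑ a ∈ A, a = ∑ b ∈ B, b → A = B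

/-- The index family `𝒫`: all `I ⊆ [r]` with `1 ≤ |I| < r/2`, together with, when `r` is even, all
`I` with `|I| = r/2` that contain the first element of `[r]`. Here `[r]` is `Fin r`, so its first
element is the one with value `0`. -/
def P (r : ℕ) : Finset (Finset (Fin r)) :=
  Finset.univ.filter fun I =>
    1 ≤ I.card ∧ (2 * I.card < r ∨ (2 * I.card = r ∧ ∃ i ∈ I, (i : ℕ) = 0))

/-- The set `𝒯` of tuples `(s_I)`, indexed by `I ∈ 𝒫`, of distinct elements of `S`. -/
def T (r : ℕ) {t : ℕ} (S : Finset (F2 t)) : Set (P r → F2 t) :=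
  {s | (∀ I, s I ∈ S) ∧ Function.Injective s}

/-- The ordered `r`-tuple `e(x, s)`, whose `i`-th coordinate is `x + ∑_{I ∈ 𝒫, i ∈ I} s_I`. -/
def e {r t : ℕ} (x : F2 t) (s : P r → F2 t) : Fin r → F2 t :=
  fun i => x + ∑ I : P r with i ∈ I.1, s I

/-- The `r`-uniform hypergraph `H_{r,t,S}` on `𝔽₂ᵗ`: an `r`-element set `{v₁, …, v_r}` is an edge if
and only if `(v₁, …, v_r) = e(x, s)` for some `x ∈ 𝔽₂ᵗ` and `s ∈ 𝒯`. -/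
def H (r t : ℕ) (S : Finset (F2 t)) : UniformHypergraph (F2 t) r where
  edges := {a | a.card = r ∧ ∃ x : F2 t, ∃ s ∈ T r S, a = Finset.univ.image (e x s)}
  sized := fun _ ha => ha.1

end SumHypergraph

/-! Replacing a set `I` by its complement only translates the edge `e x s`. So an edge amounts to a
base point (its point `0`) and distinct elements of `S` labelling the cuts of `[r]`; a `State`
extends this labelling to a permutation of `S`. By `DistinctSums`, the difference of two points
determines the set of labels of the cuts separating them. Permutations of the points act on states,
every ordered pair of adjacent `k`-edges comes from equally many states (`walkGraph_adj_iff`,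
`card_fiber_le`), and sums over the walk graph become sums over states (`exists_degree`).

Let `f` be an eigenfunction for a nontrivial `μ`, and let `F` be its value on the `k`-edge with
index set `A`. If `B` has `k` elements and meets `A` in `k - 1` of them, then `‖F_A - F_B‖² = δ²` is
proportional to `d - μ`. Moving one point of the edge changes `F` by at most `2δ`, since `F` is
`δ`-close to a function that does not see this point. Exchanging the labels of two cuts that differ
in one point is such a move. Compositions give all relabellings (`cost_relabel_le`) and then all
translations by a sum of two labels (`cost_shift_le`), at cost `O_r(δ)`. Relabellings control the
variance between labellings; translations, through the spectral gap of the Cayley graph, control the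
variance over base points. Hence `ε‖F‖² = O_r(δ²)` (`eps_sum_sq_le`), which bounds `μ` from above.

From below, `μ ≥ -d/2`, because the walk graph is built from triangles (`exists_three_neighbours`).
-/

namespace SumHypergraph

/-! ### Cuts and the points of an edge -/

/-- The nontrivial cuts of `Fin r`, each represented by its side that avoids `0`. -/
abbrev Cut (r : ℕ) [NeZero r] : Type := {I : Finset (Fin r) // I.Nonempty ∧ 0 ∉ I}

variable {r t : ℕ} {S : Finset (F2 t)}

theorem F2.add_self (a : F2 t) : a + a = 0 := by
  funext i
  exact CharTwo.add_self_eq_zero (a i)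

theorem F2.add_add_cancel (a b : F2 t) : a + b + b = a := by
  rw [add_assoc, F2.add_self, add_zero]

/-- A base point in `𝔽₂ᵗ` together with a labelling of `S`. -/
abbrev State (S : Finset (F2 t)) : Type := F2 t × Equiv.Perm S

variable [NeZero r]

theorem Cut.card_le : Fintype.card (Cut r) ≤ 2 ^ r := by
  calc Fintype.card (Cut r) ≤ Fintype.card (Finset (Fin r)) := Fintype.card_subtype_le _
    _ = 2 ^ r := by simp

/-- The `i`-th point of the edge determined by a state. -/
def pt (ι : Cut r ↪ S) (z : State S) (i : Fin r) : F2 t :=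
  z.1 + ∑ I : Cut r with i ∈ I.1, (z.2 (ι I) : F2 t)

variable (ι : Cut r ↪ S)

theorem pt_zero (z : State S) : pt ι z 0 = z.1 := by
  have : (Finset.univ.filter fun I : Cut r => (0 : Fin r) ∈ I.1) = ∅ := by
    ext I
    simpa using I.2.2
  simp only [pt, this, Finset.sum_empty, add_zero]

theorem sum_mem_add_sum_mem {α : Type*} [Fintype α] (p q : α → Prop) [DecidablePred p]
    [DecidablePred q] (g : α → F2 t) :
    (∑ I with p I, g I) + ∑ I with q I, g I = ∑ I with ¬ (p I ↔ q I), g I := by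
  rw [Finset.sum_filter, Finset.sum_filter, Finset.sum_filter, ← Finset.sum_add_distrib]
  refine Finset.sum_congr rfl fun I _ => ?_
  by_cases hp : p I <;> by_cases hq : q I <;> simp [hp, hq, F2.add_self]

/-- The elements of `S` labelling the cuts which separate `i` from `j`. -/
def sepSet (ρ : Equiv.Perm S) (i j : Fin r) : Finset S :=
  (Finset.univ.filter fun I : Cut r => ¬ (i ∈ I.1 ↔ j ∈ I.1)).map (ι.trans ρ.toEmbedding)

theorem card_sepSet_le (ρ : Equiv.Perm S) (i j : Fin r) : (sepSet ι ρ i j).card ≤ 2 ^ r := by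
  rw [sepSet, Finset.card_map]
  exact (Finset.card_filter_le _ _).trans Cut.card_le

/-- The base point and the labels of cuts containing both points cancel in characteristic two. What
remains does not depend on which side represents a cut. -/
theorem pt_add_pt (z : State S) (i j : Fin r) :
    pt ι z i + pt ι z j = ∑ a ∈ sepSet ι z.2 i j, (a : F2 t) := by
  rw [sepSet, Finset.sum_map]
  simp only [Function.Embedding.trans_apply, Equiv.coe_toEmbedding]
  rw [← sum_mem_add_sum_mem (fun I : Cut r => i ∈ I.1) (fun I : Cut r => j ∈ I.1), pt, pt]
  have := F2.add_self z.1
  calc _ = (z.1 + z.1) + ((∑ I : Cut r with i ∈ I.1, (z.2 (ι I) : F2 t)) +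
      ∑ I : Cut r with j ∈ I.1, (z.2 (ι I) : F2 t)) := by abel
    _ = _ := by rw [this, zero_add]

theorem sepSet_mul (π ρ : Equiv.Perm S) (i j : Fin r) :
    sepSet ι (π * ρ) i j = (sepSet ι ρ i j).map π.toEmbedding := by
  rw [sepSet, sepSet, Finset.map_map]
  rfl

theorem DistinctSums.eq_of_sum_eq {n : ℕ} (hS : DistinctSums S n) {X Y : Finset S}
    (hX : X.card ≤ n) (hY : Y.card ≤ n) (h : ∑ a ∈ X, (a : F2 t) = ∑ b ∈ Y, (b : F2 t)) :
    X = Y := by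
  apply Finset.map_injective (Function.Embedding.subtype _)
  apply hS
  · exact Finset.map_subtype_subset X
  · exact Finset.map_subtype_subset Y
  · simpa using hX
  · simpa using hY
  · simpa [Finset.sum_map] using h

variable {ι}

theorem sepSet_eq_of_pt_add_pt (hS : DistinctSums S (2 ^ r)) {z w : State S} {i j i' j' : Fin r}
    (h : pt ι z i + pt ι z j = pt ι w i' + pt ι w j') :
    sepSet ι z.2 i j = sepSet ι w.2 i' j' := by
  rw [pt_add_pt, pt_add_pt] at h
  exact hS.eq_of_sum_eq (card_sepSet_le ι _ _ _) (card_sepSet_le ι _ _ _) h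

/-- By `DistinctSums`, equal differences come from equal label sets, so the coincidence survives any
renaming `π` of the labels. -/
theorem pt_add_pt_mul (hS : DistinctSums S (2 ^ r)) {z w : State S} {i j i' j' : Fin r}
    (h : pt ι z i + pt ι z j = pt ι w i' + pt ι w j') (π : Equiv.Perm S) (x y : F2 t) :
    pt ι (x, π * z.2) i + pt ι (x, π * z.2) j =
      pt ι (y, π * w.2) i' + pt ι (y, π * w.2) j' := by
  have h' := sepSet_eq_of_pt_add_pt hS h
  rw [pt_add_pt, pt_add_pt]
  simp only [sepSet_mul, h']

/-- Equal points would have no separating cut, but a singleton cut separates any two indices. -/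
theorem pt_injective (hS : DistinctSums S (2 ^ r)) (z : State S) :
    Function.Injective (pt ι z) := by
  intro i j h
  by_contra hij
  have h0 : pt ι z i + pt ι z j = pt ι z i + pt ι z i := by rw [h]
  have h1 := sepSet_eq_of_pt_add_pt hS h0
  have h2 : ∃ I : Cut r, ¬ (i ∈ I.1 ↔ j ∈ I.1) := by
    by_cases hi : i = 0
    · refine ⟨⟨{j}, by simp, ?_⟩, ?_⟩
      · simpa using fun h => hij (hi.trans h)
      · simpa using hij
    · refine ⟨⟨{i}, by simp, ?_⟩, ?_⟩
      · simpa using fun h : 0 = i => hi h.symm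
      · simpa using fun h : j = i => hij h.symm
  obtain ⟨I, hI⟩ := h2
  have h3 : z.2 (ι I) ∈ sepSet ι z.2 i j :=
    Finset.mem_map_of_mem (ι.trans z.2.toEmbedding) (by simpa using hI)
  rw [h1] at h3
  simp [sepSet] at h3

/-- Two states with the same labels which agree in one point are equal. -/
theorem state_ext {z w : State S} (h : z.2 = w.2) (i : Fin r) (hi : pt ι z i = pt ι w i) :
    z = w := by
  refine Prod.ext ?_ h
  rw [pt, pt, h] at hi
  exact add_right_cancel hi

/-- Move a state so that its `i`-th point becomes `v`, changing its labels to `ρ`. -/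
def place (ι : Cut r ↪ S) (ρ : Equiv.Perm S) (i : Fin r) (v : F2 t) : State S :=
  (v + ∑ I : Cut r with i ∈ I.1, (ρ (ι I) : F2 t), ρ)

theorem pt_place (ρ : Equiv.Perm S) (i : Fin r) (v : F2 t) : pt ι (place ι ρ i v) i = v := by
  simp only [pt, place, F2.add_add_cancel]

/-! ### Permuting the points -/

/-- The representative of the cut `{I, Iᶜ}` that avoids `0`. -/
def normCut (I : Finset (Fin r)) (h : I.Nonempty) (h' : Iᶜ.Nonempty) : Cut r :=
  if h0 : 0 ∈ I then ⟨Iᶜ, h', by simpa using h0⟩ else ⟨I, h, h0⟩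

theorem sep_normCut (I : Finset (Fin r)) (h : I.Nonempty) (h' : Iᶜ.Nonempty) (i j : Fin r) :
    (i ∈ (normCut I h h').1 ↔ j ∈ (normCut I h h').1) ↔ (i ∈ I ↔ j ∈ I) := by
  unfold normCut
  split_ifs
  · simp only [Finset.mem_compl]
    tauto
  · rfl

theorem Cut.ext_sep {I J : Cut r} (h : ∀ i, (i ∈ I.1 ↔ 0 ∈ I.1) ↔ (i ∈ J.1 ↔ 0 ∈ J.1)) :
    I = J := by
  refine Subtype.ext (Finset.ext fun i => ?_)
  have := h i
  have h1 := I.2.2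
  have h2 := J.2.2
  tauto

theorem Cut.compl_map_nonempty (σ : Equiv.Perm (Fin r)) (I : Cut r) :
    (I.1.map σ.toEmbedding)ᶜ.Nonempty :=
  ⟨σ 0, by simpa using I.2.2⟩

/-- The action of a permutation of the points on the cuts. -/
def cutMap (σ : Equiv.Perm (Fin r)) (I : Cut r) : Cut r :=
  normCut (I.1.map σ.toEmbedding) I.2.1.map (I.compl_map_nonempty σ)

theorem sep_cutMap (σ : Equiv.Perm (Fin r)) (I : Cut r) (i j : Fin r) :
    (σ i ∈ (cutMap σ I).1 ↔ σ j ∈ (cutMap σ I).1) ↔ (i ∈ I.1 ↔ j ∈ I.1) := by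
  rw [cutMap, sep_normCut]
  simp

theorem cutMap_injective (σ : Equiv.Perm (Fin r)) : Function.Injective (cutMap σ) := by
  intro I J h
  apply Cut.ext_sep
  intro i
  rw [← sep_cutMap σ I, ← sep_cutMap σ J, h]

/-- The action of a permutation of the points on the cuts, as a permutation. -/
noncomputable def cutPerm (σ : Equiv.Perm (Fin r)) : Equiv.Perm (Cut r) :=
  Equiv.ofBijective (cutMap σ) (Finite.injective_iff_bijective.mp (cutMap_injective σ))

/-- Permute the points of the edge of a state. -/
noncomputable def permState (ι : Cut r ↪ S) (σ : Equiv.Perm (Fin r)) (z : State S) : State S :=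
  (pt ι z (σ 0), z.2 * (cutPerm σ).viaEmbedding ι)

theorem sepSet_permState (σ : Equiv.Perm (Fin r)) (z : State S) (i j : Fin r) :
    sepSet ι (permState ι σ z).2 i j = sepSet ι z.2 (σ i) (σ j) := by
  have h : ∀ I : Cut r, (permState ι σ z).2 (ι I) = z.2 (ι (cutMap σ I)) := fun I => by
    simp [permState, Equiv.Perm.viaEmbedding_apply, cutPerm]
  ext a
  simp only [sepSet, Finset.mem_map, Finset.mem_filter, Finset.mem_univ, true_and,
    Function.Embedding.trans_apply, Equiv.coe_toEmbedding]
  constructor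
  · rintro ⟨I, hI, rfl⟩
    exact ⟨cutMap σ I, by rwa [sep_cutMap], (h I).symm⟩
  · rintro ⟨I, hI, rfl⟩
    obtain ⟨J, rfl⟩ := (cutPerm σ).surjective I
    exact ⟨J, by rwa [← sep_cutMap σ J], h J⟩

/-- The points `0` agree by the choice of the base point, and differences to them agree because
`cutMap` preserves separation. -/
theorem pt_permState (σ : Equiv.Perm (Fin r)) (z : State S) (i : Fin r) :
    pt ι (permState ι σ z) i = pt ι z (σ i) := by
  have h1 := pt_add_pt ι (permState ι σ z) 0 i
  rw [sepSet_permState, ← pt_add_pt, pt_zero] at h1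
  exact add_left_cancel h1

theorem permState_injective (σ : Equiv.Perm (Fin r)) :
    Function.Injective (permState ι σ) := by
  intro z w h
  have h2 : z.2 = w.2 := mul_right_cancel (congrArg Prod.snd h)
  exact state_ext h2 (σ 0) (congrArg Prod.fst h)

theorem permState_bijective (σ : Equiv.Perm (Fin r)) :
    Function.Bijective (permState ι σ) :=
  Finite.injective_iff_bijective.mp (permState_injective σ)

/-! ### The edges of the hypergraph -/

/-- The cut represented by a member of `𝒫`. -/
def pCut (I : P r) : Cut r :=
  normCut I.1
    (by
      have := (Finset.mem_filter.mp I.2).2.1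
      exact Finset.card_pos.mp this)
    (by
      have h1 := (Finset.mem_filter.mp I.2).2
      rw [← Finset.card_pos, Finset.card_compl, Fintype.card_fin]
      omega)

theorem mem_P_iff {I : Finset (Fin r)} :
    I ∈ P r ↔ 1 ≤ I.card ∧ (2 * I.card < r ∨ (2 * I.card = r ∧ 0 ∈ I)) := by
  simp only [P, Finset.mem_filter, Finset.mem_univ, true_and]
  have : (∃ i ∈ I, (i : ℕ) = 0) ↔ 0 ∈ I := by
    constructor
    · rintro ⟨i, hi, h0⟩
      have : i = 0 := Fin.ext (by simpa using h0)
      exact this ▸ hi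
    · exact fun h => ⟨0, h, by simp⟩
  rw [this]

/-- Both families contain one side of each bipartition: `P` the smaller one, or in a tie the one
containing `0`; `Cut` always the one avoiding `0`. -/
theorem pCut_bijective : Function.Bijective (pCut (r := r)) := by
  constructor
  · intro I J h
    have key : I.1 = J.1 ∨ I.1 = J.1ᶜ := by
      have h' := congrArg Subtype.val h
      simp only [pCut, normCut] at h'
      split_ifs at h' <;> simp only at h'
      · exact Or.inl (compl_injective h')
      · exact Or.inr (by rw [← h', compl_compl])
      · exact Or.inr h'
      · exact Or.inl h'
    rcases key with h | h
    · exact Subtype.ext h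
    · exfalso
      have hI := mem_P_iff.mp I.2
      have hJ := mem_P_iff.mp J.2
      have hc : I.1.card + J.1.card = r := by
        rw [h, Finset.card_compl, Fintype.card_fin]
        have := J.1.card_le_univ
        rw [Fintype.card_fin] at this
        omega
      have h0 : 0 ∈ I.1 ↔ 0 ∉ J.1 := by rw [h]; simp
      rcases hI.2 with a | a <;> rcases hJ.2 with b | b <;> try omega
      exact h0.mp a.2 b.2
  · rintro ⟨I, hI, hI0⟩
    have hc : I.card + Iᶜ.card = r := by
      rw [Finset.card_compl, Fintype.card_fin]
      have := I.card_le_univ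
      rw [Fintype.card_fin] at this
      omega
    have hI1 : 0 < I.card := Finset.card_pos.mpr hI
    have hI2 : 0 < Iᶜ.card := Finset.card_pos.mpr ⟨0, by simpa using hI0⟩
    by_cases h : 2 * I.card < r
    · refine ⟨⟨I, mem_P_iff.mpr ⟨hI1, Or.inl h⟩⟩, ?_⟩
      simp [pCut, normCut, hI0]
    · refine ⟨⟨Iᶜ, mem_P_iff.mpr ⟨hI2, ?_⟩⟩, ?_⟩
      · by_cases h' : 2 * Iᶜ.card < r
        · exact Or.inl h'
        · exact Or.inr ⟨by omega, by simpa using hI0⟩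
      · simp [pCut, normCut, hI0]

theorem sep_pCut (I : P r) (i j : Fin r) :
    (i ∈ (pCut I).1 ↔ j ∈ (pCut I).1) ↔ (i ∈ I.1 ↔ j ∈ I.1) :=
  sep_normCut _ _ _ _ _

theorem e_eq_pt (x : F2 t) (s : P r → F2 t) (z : State S)
    (hs : ∀ I, s I = z.2 (ι (pCut I))) (h0 : e x s 0 = z.1) (i : Fin r) :
    e x s i = pt ι z i := by
  have h1 : e x s 0 + e x s i = pt ι z 0 + pt ι z i := by
    have : e x s 0 + e x s i = (x + x) + ((∑ I : P r with 0 ∈ I.1, s I) +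
        ∑ I : P r with i ∈ I.1, s I) := by
      simp only [e]
      abel
    rw [this, F2.add_self, zero_add, sum_mem_add_sum_mem, pt_add_pt, sepSet, Finset.sum_map]
    simp only [Function.Embedding.trans_apply, Equiv.coe_toEmbedding]
    rw [Finset.sum_filter, Finset.sum_filter,
      ← (Equiv.ofBijective _ (pCut_bijective (r := r))).sum_comp]
    refine Finset.sum_congr rfl fun I _ => ?_
    simp only [Equiv.ofBijective_apply, sep_pCut, hs]
  rw [pt_zero, h0] at h1
  exact add_left_cancel h1

theorem exists_perm_comp_eq {α β : Type*} [Finite β] (f : α ↪ β) (g : α ↪ β) :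
    ∃ ρ : Equiv.Perm β, ∀ a, ρ (f a) = g a := by
  classical
  have := Fintype.ofFinite β
  let e : Set.range f ≃ Set.range g :=
    (Equiv.ofInjective f f.injective).symm.trans (Equiv.ofInjective g g.injective)
  refine ⟨e.extendSubtype, fun a => ?_⟩
  rw [Equiv.extendSubtype_apply_of_mem e _ (Set.mem_range_self a)]
  have : (⟨f a, Set.mem_range_self a⟩ : Set.range f) = Equiv.ofInjective f f.injective a := rfl
  simp only [e, this, Equiv.trans_apply, Equiv.symm_apply_apply]
  rfl

/-- The two parametrizations have the same differences between points, so it suffices to match point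
`0`. The size condition on edges is automatic by `pt_injective`. -/
theorem mem_edges_iff (hS : DistinctSums S (2 ^ r)) (ι : Cut r ↪ S) (a : Finset (F2 t)) :
    a ∈ (H r t S).edges ↔ ∃ z : State S, a = Finset.univ.image (pt ι z) := by
  constructor
  · rintro ⟨-, x, s, ⟨hs, hinj⟩, rfl⟩
    let eP := Equiv.ofBijective _ (pCut_bijective (r := r))
    obtain ⟨ρ, hρ⟩ := exists_perm_comp_eq ι
      (eP.symm.toEmbedding.trans ⟨fun I => (⟨s I, hs I⟩ : S), fun I J h => hinj (by simpa using h)⟩)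
    refine ⟨(e x s 0, ρ), ?_⟩
    congr 1
    funext i
    refine e_eq_pt x s _ (fun I => ?_) rfl i
    rw [hρ]
    have : pCut I = eP I := rfl
    rw [this, Function.Embedding.trans_apply, Equiv.coe_toEmbedding, Equiv.symm_apply_apply]
    rfl
  · rintro ⟨z, rfl⟩
    refine ⟨?_, z.1 + ∑ I : P r with 0 ∈ I.1, (z.2 (ι (pCut I)) : F2 t),
      fun I => z.2 (ι (pCut I)), ⟨fun I => Subtype.coe_prop _, ?_⟩, ?_⟩
    · rw [Finset.card_image_of_injective _ (pt_injective hS z)]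
      simp
    · intro I J h
      exact pCut_bijective.injective (ι.injective (z.2.injective (Subtype.ext h)))
    · congr 1
      funext i
      refine (e_eq_pt _ _ _ (fun I => rfl) ?_ i).symm
      simp only [e, F2.add_add_cancel]

end SumHypergraph

namespace SumHypergraph

variable {r t : ℕ} {S : Finset (F2 t)} [NeZero r] {ι : Cut r ↪ S}

/-! ### Uniformity of the fibers -/

theorem image_eq_of_card_eq {α β : Type*} [DecidableEq β] {f g : α → β} (hf : Function.Injective f)
    (hg : Function.Injective g) {A : Finset α} {τ : α → α}
    (hτ : ∀ i ∈ A, τ i ∈ A ∧ f (τ i) = g i) : A.image f = A.image g := by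
  symm
  apply Finset.eq_of_subset_of_card_le
  · intro v hv
    obtain ⟨i, hi, rfl⟩ := Finset.mem_image.mp hv
    exact Finset.mem_image.mpr ⟨τ i, (hτ i hi).1, (hτ i hi).2⟩
  · rw [Finset.card_image_of_injective _ hf, Finset.card_image_of_injective _ hg]

open Classical in
-- Renaming labels by the permutation that turns those of `p` into those of `q`, and translating
-- suitably, injects the fiber of `p` into that of `q`. By symmetry all fibers have the same size.
theorem card_fiber_le (hS : DistinctSums S (2 ^ r)) {A B : Finset (Fin r)} {o : Fin r}
    (ho : o ∈ A) (p q : State S) :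
    (Finset.univ.filter fun z : State S => A.image (pt ι z) = A.image (pt ι p) ∧
      B.image (pt ι z) = B.image (pt ι p)).card ≤
    (Finset.univ.filter fun z : State S => A.image (pt ι z) = A.image (pt ι q) ∧
      B.image (pt ι z) = B.image (pt ι q)).card := by
  have hτ : ∀ z : State S, ∃ τ : Fin r → Fin r,
      (A.image (pt ι z) = A.image (pt ι p) ∧ B.image (pt ι z) = B.image (pt ι p)) →
      (∀ i ∈ A, τ i ∈ A ∧ pt ι z (τ i) = pt ι p i) ∧
      (∀ i ∈ B, τ i ∈ B ∧ pt ι z (τ i) = pt ι p i) := by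
    intro z
    by_cases hz : A.image (pt ι z) = A.image (pt ι p) ∧ B.image (pt ι z) = B.image (pt ι p)
    · have h : ∀ i, ∃ j, (i ∈ A → j ∈ A ∧ pt ι z j = pt ι p i) ∧
          (i ∈ B → j ∈ B ∧ pt ι z j = pt ι p i) := by
        intro i
        have hA : i ∈ A → ∃ j ∈ A, pt ι z j = pt ι p i := fun hi => by
          have := Finset.mem_image_of_mem (pt ι p) hi
          rw [← hz.1] at this
          simpa using this
        have hB : i ∈ B → ∃ j ∈ B, pt ι z j = pt ι p i := fun hi => by
          have := Finset.mem_image_of_mem (pt ι p) hi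
          rw [← hz.2] at this
          simpa using this
        by_cases hiA : i ∈ A
        · obtain ⟨j, hj, hj'⟩ := hA hiA
          refine ⟨j, fun _ => ⟨hj, hj'⟩, fun hi => ?_⟩
          obtain ⟨j', h1, h2⟩ := hB hi
          rw [← hj'] at h2
          exact ⟨pt_injective hS z h2 ▸ h1, hj'⟩
        · by_cases hiB : i ∈ B
          · obtain ⟨j, hj, hj'⟩ := hB hiB
            exact ⟨j, fun h => absurd h hiA, fun _ => ⟨hj, hj'⟩⟩
          · exact ⟨i, fun h => absurd h hiA, fun h => absurd h hiB⟩
      choose τ hτ using h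
      exact ⟨τ, fun _ => ⟨fun i => (hτ i).1, fun i => (hτ i).2⟩⟩
    · exact ⟨id, fun h => absurd h hz⟩
  choose τ hτ using hτ
  -- `τ z` matches the indices of `p` with those of `z` carrying the same points; the translation is
  -- fixed by sending the point matched with `o` to point `o` of `q`.
  let Ψ : State S → State S := fun z => place ι (q.2 * p.2⁻¹ * z.2) (τ z o) (pt ι q o)
  have key : ∀ z, (A.image (pt ι z) = A.image (pt ι p) ∧ B.image (pt ι z) = B.image (pt ι p)) →
      ∀ i, (i ∈ A ∨ i ∈ B) → pt ι (Ψ z) (τ z i) = pt ι q i := by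
    intro z hz i hi
    have h0 := ((hτ z hz).1 o ho).2
    have h1 : pt ι z (τ z i) = pt ι p i :=
      hi.elim (fun h => ((hτ z hz).1 i h).2) (fun h => ((hτ z hz).2 i h).2)
    have h2 : pt ι z (τ z o) + pt ι z (τ z i) = pt ι p o + pt ι p i := by rw [h0, h1]
    have h3 := pt_add_pt_mul hS h2 (q.2 * p.2⁻¹) (Ψ z).1 q.1
    rw [inv_mul_cancel_right] at h3
    have h4 : pt ι (Ψ z) (τ z o) = pt ι q o := pt_place _ _ _
    have h5 : pt ι (Ψ z) (τ z o) + pt ι (Ψ z) (τ z i) = pt ι q o + pt ι q i := h3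
    rw [h4] at h5
    exact add_left_cancel h5
  apply Finset.card_le_card_of_injOn Ψ
  · intro z hz
    simp only [Finset.coe_filter, Finset.mem_univ, true_and, Set.mem_ofPred_eq] at hz ⊢
    exact ⟨image_eq_of_card_eq (pt_injective hS _) (pt_injective hS _)
        fun i hi => ⟨((hτ z hz).1 i hi).1, key z hz i (Or.inl hi)⟩,
      image_eq_of_card_eq (pt_injective hS _) (pt_injective hS _)
        fun i hi => ⟨((hτ z hz).2 i hi).1, key z hz i (Or.inr hi)⟩⟩
  · intro z hz w hw hzw
    simp only [Finset.coe_filter, Finset.mem_univ, true_and, Set.mem_ofPred_eq] at hz hw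
    have h2 : z.2 = w.2 := by
      have := congrArg Prod.snd hzw
      exact mul_left_cancel this
    have h3 : τ z o = τ w o := by
      apply pt_injective hS (Ψ z)
      rw [key z hz o (Or.inl ho), hzw, key w hw o (Or.inl ho)]
    apply state_ext h2 (τ z o)
    rw [((hτ z hz).1 o ho).2, h3, ((hτ w hw).1 o ho).2]

/-! ### The `k`-edges determined by a state -/

/-- The `k`-edge formed by the points with index in `A`. -/
def kEdge (hS : DistinctSums S (2 ^ r)) (ι : Cut r ↪ S) {k : ℕ} (A : Finset (Fin r))
    (hA : A.card = k) (z : State S) : (H r t S).KEdge k :=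
  ⟨A.image (pt ι z), by rw [Finset.card_image_of_injective _ (pt_injective hS z), hA],
    Finset.univ.image (pt ι z), (mem_edges_iff hS ι _).mpr ⟨z, rfl⟩,
    Finset.image_subset_image (Finset.subset_univ A)⟩

theorem kEdge_eq_iff (hS : DistinctSums S (2 ^ r)) {k : ℕ} {A : Finset (Fin r)}
    (hA : A.card = k) {z : State S} {a : (H r t S).KEdge k} :
    kEdge hS ι A hA z = a ↔ A.image (pt ι z) = a.1 :=
  ⟨fun h => congrArg Subtype.val h, fun h => Subtype.ext h⟩

/-- The three cardinalities determine the sizes of all four cells of the Venn diagram. -/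
theorem exists_perm_image_eq {α : Type*} [Fintype α] [DecidableEq α] {A B A' B' : Finset α}
    (hA : A.card = A'.card) (hB : B.card = B'.card) (hAB : (A ∩ B).card = (A' ∩ B').card) :
    ∃ σ : Equiv.Perm α, A.image σ = A' ∧ B.image σ = B' := by
  have hcard : ∀ c : Prop × Prop, Nonempty ({i // (i ∈ A, i ∈ B) = c} ≃
      {i // (i ∈ A', i ∈ B') = c}) := by
    classical
    rintro ⟨c, d⟩
    refine ⟨Fintype.equivOfCardEq ?_⟩
    rw [Fintype.card_subtype, Fintype.card_subtype]
    simp only [Prod.mk.injEq, eq_iff_iff]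
    have e1 := Finset.card_sdiff_add_card_inter A B
    have e2 := Finset.card_sdiff_add_card_inter B A
    have e1' := Finset.card_sdiff_add_card_inter A' B'
    have e2' := Finset.card_sdiff_add_card_inter B' A'
    have e3 := Finset.card_union_add_card_inter A B
    have e3' := Finset.card_union_add_card_inter A' B'
    have e4 := Finset.card_add_card_compl (A ∪ B)
    have e4' := Finset.card_add_card_compl (A' ∪ B')
    rw [Finset.inter_comm] at e2 e2'
    by_cases hc : c <;> by_cases hd : d <;> simp only [hc, hd, iff_true, iff_false]
    · convert hAB using 2 <;> ext <;> simp
    · have : (A \ B).card = (A' \ B').card := by omega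
      convert this using 2 <;> ext <;> simp
    · have : (B \ A).card = (B' \ A').card := by omega
      convert this using 2 <;> ext <;> simp [and_comm]
    · have : (A ∪ B)ᶜ.card = (A' ∪ B')ᶜ.card := by omega
      convert this using 2 <;> ext <;> simp
  let σ : Equiv.Perm α := Equiv.ofFiberEquiv (f := fun i => (i ∈ A, i ∈ B))
    (g := fun i => (i ∈ A', i ∈ B')) fun c => (hcard c).some
  have hσ : ∀ i, (σ i ∈ A', σ i ∈ B') = (i ∈ A, i ∈ B) := fun i =>
    Equiv.ofFiberEquiv_map (f := fun i => (i ∈ A, i ∈ B))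
      (g := fun i => (i ∈ A', i ∈ B')) (fun c => (hcard c).some) i
  simp only [Prod.mk.injEq, eq_iff_iff] at hσ
  refine ⟨σ, ?_, ?_⟩
  · ext j
    obtain ⟨i, rfl⟩ := σ.surjective j
    simp [(hσ i).1]
  · ext j
    obtain ⟨i, rfl⟩ := σ.surjective j
    simp [(hσ i).2]

theorem image_pt_permState (σ : Equiv.Perm (Fin r)) (A : Finset (Fin r)) (z : State S) :
    A.image (pt ι (permState ι σ z)) = (A.image σ).image (pt ι z) := by
  rw [Finset.image_image]
  congr 1
  funext i
  exact pt_permState σ z i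

theorem exists_image_eq_of_subset {α β : Type*} [DecidableEq β] {B : Finset α} {f : α → β}
    {a : Finset β} (h : a ⊆ B.image f) : ∃ A : Finset α, a = A.image f := by
  obtain ⟨A, -, h⟩ := Finset.subset_image_iff.mp h
  exact ⟨A, h.symm⟩

theorem kEdge_surjective (hS : DistinctSums S (2 ^ r)) {k : ℕ} {A : Finset (Fin r)}
    (hA : A.card = k) : Function.Surjective (kEdge hS ι A hA) := by
  rintro ⟨a, ha, b, hb, hab⟩
  obtain ⟨z, rfl⟩ := (mem_edges_iff hS ι b).mp hb
  obtain ⟨A', rfl⟩ := exists_image_eq_of_subset hab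
  rw [Finset.card_image_of_injective _ (pt_injective hS z)] at ha
  obtain ⟨σ, hσ, -⟩ := exists_perm_image_eq (A := A) (A' := A') (B := A) (B' := A')
    (by omega) (by omega) (by rw [Finset.inter_self, Finset.inter_self]; omega)
  refine ⟨permState ι σ z, (kEdge_eq_iff hS hA).mpr ?_⟩
  rw [image_pt_permState, hσ]

/-- Two different `k`-subsets of a `(k+1)`-set share `k - 1` points, so permuting the points of an
edge brings any adjacent pair to the index sets `A`, `B`. -/
theorem walkGraph_adj_iff (hS : DistinctSums S (2 ^ r)) {k : ℕ} {A B : Finset (Fin r)}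
    (hA : A.card = k) (hB : B.card = k) (hAB : (A ∩ B).card + 1 = k)
    (a b : (H r t S).KEdge k) :
    ((H r t S).walkGraph k).Adj a b ↔
      ∃ z : State S, kEdge hS ι A hA z = a ∧ kEdge hS ι B hB z = b := by
  constructor
  · obtain ⟨a, ha, -⟩ := a
    obtain ⟨b, hb, -⟩ := b
    rintro ⟨hne, c, ⟨hc, f, hf, hcf⟩, hac, hbc⟩
    replace hne : a ≠ b := fun h => hne (Subtype.ext h)
    simp only at hac hbc
    obtain ⟨z, rfl⟩ := (mem_edges_iff hS ι f).mp hf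
    obtain ⟨C, rfl⟩ := exists_image_eq_of_subset hcf
    obtain ⟨A', rfl⟩ := exists_image_eq_of_subset hac
    obtain ⟨B', rfl⟩ := exists_image_eq_of_subset hbc
    have hinj := pt_injective (ι := ι) hS z
    rw [Finset.card_image_of_injective _ hinj] at ha hb hc
    have h1 : A' ⊆ C := (Finset.image_subset_image_iff hinj).mp hac
    have h2 : B' ⊆ C := (Finset.image_subset_image_iff hinj).mp hbc
    have h3 : (A' ∪ B').card ≤ k + 1 := hc ▸ Finset.card_le_card (Finset.union_subset h1 h2)
    have h4 : (A' ∩ B').card < k := by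
      by_contra h
      apply hne
      have e1 : A' ∩ B' = A' := Finset.eq_of_subset_of_card_le Finset.inter_subset_left (by omega)
      have e2 : A' ∩ B' = B' := Finset.eq_of_subset_of_card_le Finset.inter_subset_right (by omega)
      rw [← e1, e2]
    have h5 := Finset.card_union_add_card_inter A' B'
    obtain ⟨σ, hσA, hσB⟩ := exists_perm_image_eq (A := A) (A' := A') (B := B) (B' := B')
      (by omega) (by omega) (by omega)
    refine ⟨permState ι σ z, (kEdge_eq_iff hS hA).mpr ?_, (kEdge_eq_iff hS hB).mpr ?_⟩
    · rw [image_pt_permState, hσA]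
    · rw [image_pt_permState, hσB]
  · rintro ⟨z, rfl, rfl⟩
    have hinj := pt_injective (ι := ι) hS z
    refine ⟨fun h => ?_, (A ∪ B).image (pt ι z), ⟨?_, Finset.univ.image (pt ι z), ?_, ?_⟩, ?_, ?_⟩
    · have h' : A = B := Finset.image_injective hinj (congrArg Subtype.val h)
      rw [h', Finset.inter_self] at hAB
      omega
    · rw [Finset.card_image_of_injective _ hinj]
      have := Finset.card_union_add_card_inter A B
      omega
    · exact (mem_edges_iff hS ι _).mpr ⟨z, rfl⟩
    · exact Finset.image_subset_image (Finset.subset_univ _)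
    · exact Finset.image_subset_image Finset.subset_union_left
    · exact Finset.image_subset_image Finset.subset_union_right

/-! ### Sums over states and sums over the walk graph -/

open Classical in
theorem exists_sum_comp_eq {X Y : Type*} [Fintype X] [Nonempty X] [Fintype Y] (φ : X → Y)
    {R : Y → Prop} (hR : ∀ y, R y ↔ ∃ x, φ x = y)
    (hN : ∀ x x', (Finset.univ.filter fun w => φ w = φ x).card =
      (Finset.univ.filter fun w => φ w = φ x').card) :
    ∃ N : ℕ, 0 < N ∧ ∀ G : Y → ℝ, ∑ x, G (φ x) = N * ∑ y with R y, G y := by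
  obtain ⟨o⟩ := ‹Nonempty X›
  refine ⟨(Finset.univ.filter fun w => φ w = φ o).card,
    Finset.card_pos.mpr ⟨o, by simp⟩, fun G => ?_⟩
  rw [← Finset.sum_fiberwise Finset.univ φ, Finset.mul_sum, Finset.sum_filter]
  refine Finset.sum_congr rfl fun y _ => ?_
  rw [Finset.sum_congr rfl (g := fun _ => G y) fun x hx => by rw [(Finset.mem_filter.mp hx).2],
    Finset.sum_const, nsmul_eq_mul]
  split_ifs with h
  · obtain ⟨x, rfl⟩ := (hR y).mp h
    rw [hN x o]
  · have : (Finset.univ.filter fun x' => φ x' = y) = ∅ := by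
      rw [Finset.filter_eq_empty_iff]
      exact fun x _ hx => h ((hR y).mpr ⟨x, hx⟩)
    simp [this]

open Classical in
theorem card_fiber_eq (hS : DistinctSums S (2 ^ r)) {k : ℕ} (hk : 1 ≤ k) {A B : Finset (Fin r)}
    (hA : A.card = k) (hB : B.card = k) (p q : State S) :
    (Finset.univ.filter fun z : State S => (kEdge hS ι A hA z, kEdge hS ι B hB z) =
      (kEdge hS ι A hA p, kEdge hS ι B hB p)).card =
    (Finset.univ.filter fun z : State S => (kEdge hS ι A hA z, kEdge hS ι B hB z) =
      (kEdge hS ι A hA q, kEdge hS ι B hB q)).card := by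
  obtain ⟨o, ho⟩ : A.Nonempty := Finset.card_pos.mp (by omega)
  simp only [Prod.mk.injEq, kEdge_eq_iff]
  exact le_antisymm (card_fiber_le hS ho p q) (card_fiber_le hS ho q p)

open Classical in
/-- Sums over states of functions of two neighbouring `k`-edges are proportional to sums over the
edges of the walk graph. -/
theorem exists_sum_kEdge_pair_eq (hS : DistinctSums S (2 ^ r)) {k : ℕ} (hk : 1 ≤ k)
    {A B : Finset (Fin r)} (hA : A.card = k) (hB : B.card = k) (hAB : (A ∩ B).card + 1 = k) :
    ∃ N : ℕ, 0 < N ∧ ∀ G : (H r t S).KEdge k → (H r t S).KEdge k → ℝ,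
      ∑ z : State S, G (kEdge hS ι A hA z) (kEdge hS ι B hB z) =
        N * ∑ a, ∑ b with ((H r t S).walkGraph k).Adj a b, G a b := by
  obtain ⟨N, hN, h⟩ := exists_sum_comp_eq
    (fun z : State S => (kEdge hS ι A hA z, kEdge hS ι B hB z))
    (R := fun y => ((H r t S).walkGraph k).Adj y.1 y.2)
    (fun y => by
      rw [walkGraph_adj_iff (ι := ι) hS hA hB hAB]
      simp only [Prod.ext_iff])
    (fun p q => by convert card_fiber_eq (ι := ι) hS hk hA hB p q)
  refine ⟨N, hN, fun G => ?_⟩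
  rw [h fun y => G y.1 y.2]
  congr 1
  simp only [Finset.sum_filter]
  rw [Fintype.sum_prod_type]

open Classical in
theorem exists_sum_kEdge_eq (hS : DistinctSums S (2 ^ r)) {k : ℕ} (hk : 1 ≤ k)
    {A : Finset (Fin r)} (hA : A.card = k) (ι : Cut r ↪ S) :
    ∃ N : ℕ, 0 < N ∧ ∀ G : (H r t S).KEdge k → ℝ,
      ∑ z : State S, G (kEdge hS ι A hA z) = N * ∑ a, G a := by
  obtain ⟨N, hN, h⟩ := exists_sum_comp_eq (kEdge hS ι A hA) (R := fun _ => True)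
    (fun y => by simpa using kEdge_surjective hS hA y)
    (fun p q => by simpa using card_fiber_eq hS hk hA hA p q)
  exact ⟨N, hN, fun G => by simpa using h G⟩

open Classical in
/-- The walk graph is regular, and its degree relates sums over its edges to sums over states. -/
theorem exists_degree (hS : DistinctSums S (2 ^ r)) {k : ℕ} (hk : 1 ≤ k)
    {A B : Finset (Fin r)} (hA : A.card = k) (hB : B.card = k) (hAB : (A ∩ B).card + 1 = k)
    (ι : Cut r ↪ S) :
    ∃ d N : ℕ, 0 < d ∧ 0 < N ∧
      (∀ a, (Finset.univ.filter fun b => ((H r t S).walkGraph k).Adj a b).card = d) ∧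
      (∀ G : (H r t S).KEdge k → ℝ,
        ∑ z : State S, G (kEdge hS ι A hA z) = N * d * ∑ a, G a) ∧
      ∀ G : (H r t S).KEdge k → (H r t S).KEdge k → ℝ,
        ∑ z : State S, G (kEdge hS ι A hA z) (kEdge hS ι B hB z) =
          N * ∑ a, ∑ b with ((H r t S).walkGraph k).Adj a b, G a b := by
  obtain ⟨N, hN, h2⟩ := exists_sum_kEdge_pair_eq (ι := ι) hS hk hA hB hAB
  obtain ⟨M, hM, h1⟩ := exists_sum_kEdge_eq hS hk hA ι
  have key : ∀ a, N * (Finset.univ.filter fun b => ((H r t S).walkGraph k).Adj a b).card = M := by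
    intro a
    -- Testing both formulas on the indicator of `a` computes its degree as `M / N`.
    have e1 := h1 fun a' => if a' = a then 1 else 0
    have e2 := h2 fun a' _ => if a' = a then 1 else 0
    rw [e1] at e2
    simp only [Finset.sum_const, nsmul_eq_mul, mul_ite, mul_one, mul_zero, Finset.sum_ite_eq',
      Finset.mem_univ, if_true] at e2
    exact_mod_cast e2.symm
  let a₀ := kEdge hS ι A hA ((0, 1) : State S)
  refine ⟨(Finset.univ.filter fun b => ((H r t S).walkGraph k).Adj a₀ b).card, N, ?_, hN,
    fun a => ?_, fun G => ?_, h2⟩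
  · rw [← key a₀] at hM
    exact Nat.pos_of_mul_pos_left hM
  · exact Nat.eq_of_mul_eq_mul_left hN ((key a).trans (key a₀).symm)
  · rw [h1, ← key a₀]
    push_cast
    ring

end SumHypergraph

namespace SumHypergraph

variable {r t : ℕ} {S : Finset (F2 t)} [NeZero r] {ι : Cut r ↪ S}

/-! ### The cost of a move -/

/-- The `ℓ²`-norm of a function on a finite type. -/
noncomputable def l2 {X : Type*} [Fintype X] (F : X → ℝ) : ℝ := √(∑ x, F x ^ 2)

section L2
variable {X : Type*} [Fintype X]

theorem l2_eq_norm (F : X → ℝ) : l2 F = ‖(WithLp.toLp 2 F : EuclideanSpace ℝ X)‖ := by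
  simp [l2, EuclideanSpace.norm_eq]

theorem l2_nonneg (F : X → ℝ) : 0 ≤ l2 F := Real.sqrt_nonneg _

theorem l2_sq (F : X → ℝ) : l2 F ^ 2 = ∑ x, F x ^ 2 :=
  Real.sq_sqrt (Finset.sum_nonneg fun _ _ => sq_nonneg _)

theorem l2_add_le (F G : X → ℝ) : l2 (fun x => F x + G x) ≤ l2 F + l2 G := by
  simp only [l2_eq_norm]
  exact norm_add_le (WithLp.toLp 2 F : EuclideanSpace ℝ X) (WithLp.toLp 2 G)

theorem l2_sub_comm (F G : X → ℝ) : l2 (fun x => F x - G x) = l2 fun x => G x - F x := by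
  simp only [l2]
  congr 1
  exact Finset.sum_congr rfl fun x _ => by ring

theorem l2_comp {φ : X → X} (hφ : Function.Bijective φ) (F : X → ℝ) :
    l2 (fun x => F (φ x)) = l2 F := by
  simp only [l2]
  rw [hφ.sum_comp fun x => F x ^ 2]

/-- How far `F` is from being invariant under `φ`, in `ℓ²`. -/
noncomputable def cost (F : X → ℝ) (φ : X → X) : ℝ := l2 fun x => F (φ x) - F x

theorem cost_nonneg (F : X → ℝ) (φ : X → X) : 0 ≤ cost F φ := l2_nonneg _

theorem cost_comp_le (F : X → ℝ) (φ : X → X) {ψ : X → X} (hψ : Function.Bijective ψ) :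
    cost F (fun x => φ (ψ x)) ≤ cost F φ + cost F ψ := by
  have h := l2_add_le (fun x => F (φ (ψ x)) - F (ψ x)) fun x => F (ψ x) - F x
  rw [l2_comp hψ fun x => F (φ x) - F x] at h
  simpa [cost] using h

theorem cost_eq_zero {F : X → ℝ} {φ : X → X} (h : ∀ x, F (φ x) = F x) : cost F φ = 0 := by
  simp [cost, l2, h]

theorem cost_le_of_l2_sub_le {F G : X → ℝ} {φ : X → X} (hφ : Function.Bijective φ) {δ : ℝ}
    (h : l2 (fun x => F x - G x) ≤ δ) (hG : ∀ x, G (φ x) = G x) : cost F φ ≤ 2 * δ := by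
  have h1 := l2_add_le (fun x => F (φ x) - G (φ x)) fun x => G x - F x
  rw [l2_comp hφ fun x => F x - G x, l2_sub_comm G F] at h1
  have h2 : cost F φ ≤ l2 (fun x => F x - G x) + l2 (fun x => F x - G x) := by
    simpa [cost, hG] using h1
  linarith

end L2

/-- A function on states depends only on the points of the state. -/
def DependsOnPt (ι : Cut r ↪ S) (F : State S → ℝ) : Prop :=
  ∀ z w, pt ι z = pt ι w → F z = F w

/-- Moving a single point of the edge changes `F` by at most `D` in `ℓ²`. -/
def PointMoveBound (ι : Cut r ↪ S) (F : State S → ℝ) (D : ℝ) : Prop :=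
  ∀ i : Fin r, ∀ φ : State S → State S, Function.Bijective φ →
    (∀ z, ∀ j ≠ i, pt ι (φ z) j = pt ι z j) → cost F φ ≤ D

/-- Relabel a state. -/
def relabel (κ : Equiv.Perm S) (z : State S) : State S := (z.1, z.2 * κ)

theorem relabel_bijective (κ : Equiv.Perm S) : Function.Bijective (relabel κ) := by
  refine Function.bijective_iff_has_inverse.mpr ⟨relabel κ⁻¹, fun z => ?_, fun z => ?_⟩ <;>
    simp [relabel]

theorem cost_relabel_mul_le (F : State S → ℝ) (κ κ' : Equiv.Perm S) :
    cost F (relabel (κ * κ')) ≤ cost F (relabel κ) + cost F (relabel κ') := by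
  have h := cost_comp_le F (relabel κ') (relabel_bijective κ)
  have h' : relabel (κ * κ') = fun z => relabel κ' (relabel κ z) := by
    funext z
    simp [relabel, mul_assoc]
  rw [h']
  linarith

theorem cost_relabel_one (F : State S → ℝ) : cost F (relabel 1) = 0 :=
  cost_eq_zero fun z => by simp [relabel]

/-- Conjugation: `(a c) = (b c)(a b)(b c)`. -/
theorem cost_relabel_swap_le (F : State S → ℝ) (a b c : S) :
    cost F (relabel (Equiv.swap a c)) ≤
      cost F (relabel (Equiv.swap a b)) + 2 * cost F (relabel (Equiv.swap b c)) := by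
  have h1 := cost_nonneg F (relabel (Equiv.swap a b))
  have h2 := cost_nonneg F (relabel (Equiv.swap b c))
  by_cases hab : a = b
  · subst hab
    linarith
  by_cases hac : a = c
  · subst hac
    rw [Equiv.swap_self]
    have := cost_relabel_one F
    change cost F (relabel 1) ≤ _
    linarith
  · have h : Equiv.swap a c = Equiv.swap b c * Equiv.swap a b * Equiv.swap b c := by
      rw [Equiv.swap_mul_swap_mul_swap hab hac, Equiv.swap_comm]
    have h3 := cost_relabel_mul_le F (Equiv.swap b c * Equiv.swap a b) (Equiv.swap b c)
    have h4 := cost_relabel_mul_le F (Equiv.swap b c) (Equiv.swap a b)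
    rw [h]
    linarith

/-! ### Relabellings and translations as compositions of point moves -/

section Moves
variable {F : State S → ℝ} {D : ℝ}

theorem PointMoveBound.nonneg (hD : PointMoveBound ι F D) : 0 ≤ D := by
  have := hD 0 id Function.bijective_id (fun _ _ _ => rfl)
  exact (cost_nonneg _ _).trans this

/-- A point other than `i` lies in both cuts or in neither, so it does not notice the exchange. -/
theorem cost_swap_insert_le (hD : PointMoveBound ι F D) {I J : Cut r} {i : Fin r}
    (hIJ : ∀ j ≠ i, (j ∈ I.1 ↔ j ∈ J.1)) :
    cost F (relabel (Equiv.swap (ι I) (ι J))) ≤ D := by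
  refine hD i _ (relabel_bijective _) fun z j hj => ?_
  simp only [pt, relabel, Equiv.Perm.mul_apply]
  congr 1
  rw [Finset.sum_filter, Finset.sum_filter, ← Equiv.sum_comp (Equiv.swap I J)]
  refine Finset.sum_congr rfl fun I' _ => ?_
  rw [Function.Embedding.swap_apply, Equiv.swap_apply_self]
  have : j ∈ (Equiv.swap I J I').1 ↔ j ∈ I'.1 := by
    rw [Equiv.swap_apply_def]
    split_ifs with h1 h2
    · rw [h1, hIJ j hj]
    · rw [h2, hIJ j hj]
    · rfl
  simp only [this]

/-- The label of `{i}` enters only point `i`, and `u` labels no cut. -/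
theorem cost_swap_singleton_le (hD : PointMoveBound ι F D) {I : Cut r} {i : Fin r}
    (hI : I.1 = {i}) {u : S} (hu : u ∉ Set.range ι) :
    cost F (relabel (Equiv.swap (ι I) u)) ≤ D := by
  refine hD i _ (relabel_bijective _) fun z j hj => ?_
  simp only [pt, relabel, Equiv.Perm.mul_apply]
  congr 1
  refine Finset.sum_congr rfl fun I' hI' => ?_
  rw [Equiv.swap_apply_of_ne_of_ne]
  · intro h
    rw [ι.injective h] at hI'
    exact hj (by simpa [hI] using hI')
  · exact fun h => hu ⟨I', h⟩

/-- Shrink `J` to `I` one point at a time; each conjugating exchange is used twice. -/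
theorem cost_swap_of_subset_le (hD : PointMoveBound ι F D) (n : ℕ) :
    ∀ I J : Cut r, I.1 ⊆ J.1 → (J.1 \ I.1).card = n →
      cost F (relabel (Equiv.swap (ι I) (ι J))) ≤ 2 * n * D := by
  induction n with
  | zero =>
    intro I J hIJ h
    have : I = J := Subtype.ext (hIJ.antisymm (by simpa [Finset.sdiff_eq_empty_iff_subset] using h))
    rw [this, Equiv.swap_self]
    have := cost_relabel_one F
    change cost F (relabel 1) ≤ _
    simp [this]
  | succ n ih =>
    intro I J hIJ h
    obtain ⟨i, hi⟩ : (J.1 \ I.1).Nonempty := Finset.card_pos.mp (by omega)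
    obtain ⟨hiJ, hiI⟩ := Finset.mem_sdiff.mp hi
    have hIJ' : I.1 ⊆ J.1.erase i := fun j hj =>
      Finset.mem_erase.mpr ⟨fun e => hiI (e ▸ hj), hIJ hj⟩
    let J' : Cut r := ⟨J.1.erase i, I.2.1.mono hIJ', fun h0 => J.2.2 (Finset.mem_of_mem_erase h0)⟩
    have h1 := ih I J' hIJ' (by
      have : J'.1 \ I.1 = (J.1 \ I.1).erase i := by
        ext j
        simp only [J', Finset.mem_sdiff, Finset.mem_erase]
        tauto
      rw [this, Finset.card_erase_of_mem hi, h, Nat.add_sub_cancel])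
    have h2 := cost_swap_insert_le hD (I := J') (J := J) (i := i) fun j hj => by simp [J', hj]
    have h3 := cost_relabel_swap_le F (ι I) (ι J') (ι J)
    push_cast
    linarith

/-- The cut that separates `0` from all other points. -/
def topCut (hr : 1 < r) : Cut r :=
  ⟨Finset.univ.erase 0, ⟨⟨1, hr⟩, by
    simp only [Finset.mem_erase, Finset.mem_univ, and_true, ne_eq, Fin.ext_iff]
    simp⟩, by simp⟩

theorem cost_swap_topCut_le (hr : 1 < r) (hD : PointMoveBound ι F D) (I : Cut r) :
    cost F (relabel (Equiv.swap (ι I) (ι (topCut hr)))) ≤ 2 * r * D := by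
  have hI : I.1 ⊆ (topCut hr).1 := fun j hj =>
    Finset.mem_erase.mpr ⟨fun e => I.2.2 (e ▸ hj), Finset.mem_univ j⟩
  refine (cost_swap_of_subset_le hD _ I _ hI rfl).trans ?_
  have h1 : ((topCut hr).1 \ I.1).card ≤ r := by
    simpa using Finset.card_le_univ ((topCut hr).1 \ I.1)
  have h2 : ((((topCut hr).1 \ I.1).card : ℕ) : ℝ) ≤ r := by exact_mod_cast h1
  have := hD.nonneg
  gcongr

theorem cost_swap_cut_cut_le (hr : 1 < r) (hD : PointMoveBound ι F D) (I J : Cut r) :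
    cost F (relabel (Equiv.swap (ι I) (ι J))) ≤ 6 * r * D := by
  have h1 := cost_relabel_swap_le F (ι I) (ι (topCut hr)) (ι J)
  have h2 := cost_swap_topCut_le hr hD I
  have h3 := cost_swap_topCut_le hr hD J
  rw [Equiv.swap_comm (ι J)] at h3
  linarith

/-- An unused label is reached through the singleton cut `{1}`, at cost `6rD + 2D`. -/
theorem cost_swap_cut_le (hr : 1 < r) (hD : PointMoveBound ι F D) (I : Cut r) (w : S) :
    cost F (relabel (Equiv.swap (ι I) w)) ≤ 8 * r * D := by
  have hr' : (1 : ℝ) ≤ r := by exact_mod_cast hr.le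
  have hD0 := hD.nonneg
  have hrD : D ≤ r * D := le_mul_of_one_le_left hD0 hr'
  by_cases hw : w ∈ Set.range ι
  · obtain ⟨J, rfl⟩ := hw
    have := cost_swap_cut_cut_le hr hD I J
    linarith
  · let J : Cut r := ⟨{⟨1, hr⟩}, by simp, by simp [Fin.ext_iff]⟩
    have h1 := cost_relabel_swap_le F (ι I) (ι J) w
    have h2 := cost_swap_cut_cut_le hr hD I J
    have h3 := cost_swap_singleton_le hD (I := J) rfl hw
    linarith

theorem exists_relabel_agree (hr : 1 < r) (hD : PointMoveBound ι F D) (κ : Equiv.Perm S)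
    (A : Finset (Cut r)) : ∃ κ' : Equiv.Perm S, (∀ I ∈ A, κ' (ι I) = κ (ι I)) ∧
      cost F (relabel κ') ≤ A.card * (8 * r * D) := by
  induction A using Finset.induction_on with
  | empty => exact ⟨1, by simp, by simp [cost_relabel_one]⟩
  | insert J A hJ ih =>
    obtain ⟨κ', h1, h2⟩ := ih
    -- One transposition corrects the label of `J`; it moves no `ι I` with `I ∈ A`, because `κ'`
    -- already agrees with `κ` there.
    refine ⟨κ' * Equiv.swap (ι J) (κ'⁻¹ (κ (ι J))), fun I hI => ?_, ?_⟩
    · rcases Finset.mem_insert.mp hI with rfl | hI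
      · simp
      · have hIJ : I ≠ J := fun e => hJ (e ▸ hI)
        rw [Equiv.Perm.mul_apply, Equiv.swap_apply_of_ne_of_ne, h1 I hI]
        · exact fun e => hIJ (ι.injective e)
        · intro e
          have e' := congrArg κ' e
          rw [h1 I hI, ← Equiv.Perm.mul_apply, mul_inv_cancel, Equiv.Perm.one_apply] at e'
          exact hIJ (ι.injective (κ.injective e'))
    · rw [Finset.card_insert_of_notMem hJ]
      have h3 := cost_relabel_mul_le F κ' (Equiv.swap (ι J) (κ'⁻¹ (κ (ι J))))
      have h4 := cost_swap_cut_le hr hD J (κ'⁻¹ (κ (ι J)))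
      push_cast
      linarith

/-- `F` sees only the labels of the at most `2 ^ r` cuts, so that many transpositions suffice,
however large `S` is. -/
theorem cost_relabel_le (hr : 1 < r) (hF : DependsOnPt ι F) (hD : PointMoveBound ι F D)
    (κ : Equiv.Perm S) : cost F (relabel κ) ≤ 8 * r * 2 ^ r * D := by
  obtain ⟨κ', h1, h2⟩ := exists_relabel_agree hr hD κ Finset.univ
  have h3 : cost F (relabel κ) = cost F (relabel κ') := by
    simp only [cost]
    congr 1
    funext z
    rw [hF (relabel κ z) (relabel κ' z)]
    funext i
    simp [pt, relabel, h1]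
  have h4 : ((Finset.univ : Finset (Cut r)).card : ℝ) ≤ 2 ^ r := by
    exact_mod_cast Cut.card_le (r := r)
  have hD0 := hD.nonneg
  calc cost F (relabel κ) ≤ (Finset.univ : Finset (Cut r)).card * (8 * r * D) := h3 ▸ h2
    _ ≤ 2 ^ r * (8 * r * D) := by gcongr
    _ = 8 * r * 2 ^ r * D := by ring

/-- Translate the base point of a state by the sum of two labels. -/
def shift (a b : S) (z : State S) : State S := (z.1 + (z.2 a + z.2 b : F2 t), z.2)

theorem shift_bijective (a b : S) : Function.Bijective (shift a b) := by
  have : Function.Involutive (shift a b) := fun z => by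
    simp only [shift, F2.add_add_cancel]
  exact this.bijective

/-- Change the label of the top cut to an unused one, moving only the point `0`. -/
def moveZero (a b : S) (z : State S) : State S := relabel (Equiv.swap a b) (shift a b z)

/-- Every point other than `0` lies in the top cut, where the change of label cancels the
translation. -/
theorem cost_moveZero_le (hr : 1 < r) (hD : PointMoveBound ι F D) {u : S}
    (hu : u ∉ Set.range ι) : cost F (moveZero (ι (topCut hr)) u) ≤ D := by
  refine hD 0 _ ((relabel_bijective _).comp (shift_bijective _ _)) fun z j hj => ?_
  have hmem : topCut hr ∈ Finset.univ.filter fun I : Cut r => j ∈ I.1 := by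
    simp [topCut, hj]
  simp only [pt, moveZero, relabel, shift, Equiv.Perm.mul_apply]
  rw [← Finset.add_sum_erase _ _ hmem, ← Finset.add_sum_erase _ _ hmem, Equiv.swap_apply_left]
  rw [Finset.sum_congr rfl (g := fun I : Cut r => (z.2 (ι I) : F2 t))]
  · have := F2.add_self (z.2 u : F2 t)
    calc _ = z.1 + ((z.2 (ι (topCut hr)) : F2 t) + ∑ I ∈ (Finset.univ.filter
          fun I : Cut r => j ∈ I.1).erase (topCut hr), (z.2 (ι I) : F2 t)) +
          ((z.2 u : F2 t) + z.2 u) := by abel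
      _ = _ := by rw [this, add_zero]
  · intro I hI
    rw [Equiv.swap_apply_of_ne_of_ne]
    · exact fun e => Finset.ne_of_mem_erase hI (ι.injective e)
    · exact fun e => hu ⟨I, e⟩

theorem cost_shift_top_le (hr : 1 < r) (hD : PointMoveBound ι F D) {u : S}
    (hu : u ∉ Set.range ι) : cost F (shift (ι (topCut hr)) u) ≤ (8 * r + 1) * D := by
  have h1 := cost_moveZero_le hr hD hu
  have h2 := cost_swap_cut_le hr hD (topCut hr) u
  have h3 := cost_comp_le F (relabel (Equiv.swap (ι (topCut hr)) u))
    ((relabel_bijective (Equiv.swap (ι (topCut hr)) u)).comp (shift_bijective (ι (topCut hr)) u))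
  have h4 : (fun z => relabel (Equiv.swap (ι (topCut hr)) u)
      ((relabel (Equiv.swap (ι (topCut hr)) u) ∘ shift (ι (topCut hr)) u) z)) =
      shift (ι (topCut hr)) u := by
    funext z
    simp [relabel, mul_assoc]
  rw [h4] at h3
  have h5 : cost F (relabel (Equiv.swap (ι (topCut hr)) u) ∘ shift (ι (topCut hr)) u) ≤ D := h1
  linarith

/-- Conjugating by a relabelling carries the label of the top cut and an unused label to `a` and
`b`. The bound on `S.card` provides the unused label. -/
theorem cost_shift_le (hr : 1 < r) (hF : DependsOnPt ι F) (hD : PointMoveBound ι F D)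
    (hS : 2 ^ r < S.card) (a b : S) : cost F (shift a b) ≤ 32 * r * 2 ^ r * D := by
  have hr' : (1 : ℝ) ≤ r := by exact_mod_cast hr.le
  have h2r : (1 : ℝ) ≤ 2 ^ r := one_le_pow₀ (by norm_num)
  have hD0 := hD.nonneg
  by_cases hab : a = b
  · subst hab
    rw [cost_eq_zero fun z => by simp [shift, F2.add_self]]
    positivity
  obtain ⟨u, hu⟩ : ∃ u, u ∉ Set.range ι := by
    by_contra! h
    have h1 := Fintype.card_le_of_surjective ι h
    rw [Fintype.card_coe] at h1
    have h2 := Cut.card_le (r := r)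
    omega
  have hne : ι (topCut hr) ≠ u := fun e => hu ⟨_, e⟩
  obtain ⟨κ, hκ⟩ := exists_perm_comp_eq
    (⟨![ι (topCut hr), u], by
      intro i j h
      fin_cases i <;> fin_cases j <;> simp_all⟩ : Fin 2 ↪ S)
    (⟨![a, b], by
      intro i j h
      fin_cases i <;> fin_cases j <;> simp_all⟩ : Fin 2 ↪ S)
  have ha : κ (ι (topCut hr)) = a := hκ 0
  have hb : κ u = b := hκ 1
  have e1 : shift a b = fun z => relabel κ⁻¹ (shift (ι (topCut hr)) u (relabel κ z)) := by
    funext z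
    simp [relabel, shift, ha, hb]
  have h1 := cost_comp_le F (fun z => relabel κ⁻¹ (shift (ι (topCut hr)) u z))
    (relabel_bijective κ)
  have h2 := cost_comp_le F (relabel κ⁻¹) (shift_bijective (ι (topCut hr)) u)
  have h3 := cost_relabel_le hr hF hD κ
  have h4 := cost_relabel_le hr hF hD κ⁻¹
  have h5 := cost_shift_top_le hr hD hu
  rw [e1]
  have h6 : (8 * r + 1) * D ≤ 16 * r * 2 ^ r * D := by
    gcongr
    nlinarith
  linarith

end Moves

end SumHypergraph

namespace SumHypergraph

/-! ### The Poincaré inequality of the Cayley graph -/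

section Spectral

theorem LinearMap.IsSymmetric.norm_sq_apply_le {E : Type*} [NormedAddCommGroup E]
    [InnerProductSpace ℝ E] [FiniteDimensional ℝ E] {T : E →ₗ[ℝ] E} (hT : T.IsSymmetric) {ρ : ℝ}
    (h : ∀ μ, Module.End.HasEigenvalue T μ → |μ| ≤ ρ) (x : E) :
    ‖T x‖ ^ 2 ≤ ρ ^ 2 * ‖x‖ ^ 2 := by
  let b := hT.eigenvectorBasis rfl
  rw [← b.repr.norm_map (T x), ← b.repr.norm_map x, EuclideanSpace.norm_sq_eq,
    EuclideanSpace.norm_sq_eq, Finset.mul_sum]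
  refine Finset.sum_le_sum fun i _ => ?_
  have h1 : b.repr (T x) i = hT.eigenvalues rfl i * b.repr x i :=
    hT.eigenvectorBasis_apply_self_apply rfl x i
  have h2 := h _ (hT.hasEigenvalue_eigenvalues rfl i)
  rw [h1, norm_mul, mul_pow]
  have h3 : ‖((hT.eigenvalues rfl i : ℝ))‖ ^ 2 ≤ ρ ^ 2 :=
    pow_le_pow_left₀ (norm_nonneg _) h2 2
  exact mul_le_mul_of_nonneg_right h3 (sq_nonneg _)

variable {V : Type*} [Fintype V]

/-- The functions with mean zero. -/
def meanZero (V : Type*) [Fintype V] : Submodule ℝ (EuclideanSpace ℝ V) where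
  carrier := {g | ∑ v, g v = 0}
  add_mem' {f g} hf hg := by
    have hf' : ∑ v, f v = 0 := hf
    have hg' : ∑ v, g v = 0 := hg
    change ∑ v, (f + g) v = 0
    simp [Finset.sum_add_distrib, hf', hg']
  zero_mem' := by
    change ∑ v, (0 : EuclideanSpace ℝ V) v = 0
    simp
  smul_mem' c g hg := by
    have hg' : ∑ v, g v = 0 := hg
    change ∑ v, (c • g) v = 0
    simp [← Finset.mul_sum, hg']

theorem mem_meanZero {g : EuclideanSpace ℝ V} : g ∈ meanZero V ↔ ∑ v, g v = 0 := Iff.rfl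

open Classical in
/-- A symmetric matrix with constant row sums, restricted to the functions with mean zero. -/
theorem exists_isSymmetric_meanZero {M : Matrix V V ℝ} (hM : M.IsSymm) {d : ℝ}
    (hd : ∀ v, ∑ w, M v w = d) : ∃ T : meanZero V →ₗ[ℝ] meanZero V, T.IsSymmetric ∧
      ∀ g : meanZero V, ∀ v, (T g).1 v = M.mulVec (g.1) v := by
  have hsymm : (Matrix.toEuclideanLin M).IsSymmetric :=
    Matrix.isSymmetric_toEuclideanLin_iff.mpr (by
      rw [Matrix.IsHermitian, Matrix.conjTranspose_eq_transpose_of_trivial]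
      exact hM)
  have hinv : ∀ g ∈ meanZero V, Matrix.toEuclideanLin M g ∈ meanZero V := by
    intro g hg
    rw [mem_meanZero] at hg ⊢
    have h1 : ∀ v, Matrix.toEuclideanLin M g v = ∑ w, M v w * g w := fun v => rfl
    simp only [h1]
    rw [Finset.sum_comm]
    have h2 : ∀ w, ∑ v, M v w * g w = d * g w := fun w => by
      rw [← Finset.sum_mul, ← hd w]
      congr 1
      exact Finset.sum_congr rfl fun v _ => hM.apply w v
    simp only [h2, ← Finset.mul_sum, hg, mul_zero]
  exact ⟨(Matrix.toEuclideanLin M).restrict hinv, hsymm.restrict_invariant hinv, fun g v => rfl⟩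

/-- Spectral theorem on the mean-zero functions. If this space is nonzero, an eigenvalue exists,
which forces `ρ ≥ 0`. -/
theorem sum_sq_mulVec_le {M : Matrix V V ℝ} (hM : M.IsSymm) {d ρ : ℝ}
    (hd : ∀ v, ∑ w, M v w = d)
    (h : ∀ μ : ℝ, ∀ f : V → ℝ, f ≠ 0 → ∑ v, f v = 0 → M.mulVec f = μ • f → |μ| ≤ ρ) {g : V → ℝ}
    (hg : ∑ v, g v = 0) :
    ∑ v, (M.mulVec g v) ^ 2 ≤ ρ ^ 2 * ∑ v, g v ^ 2 ∧ (g ≠ 0 → 0 ≤ ρ) := by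
  obtain ⟨T, hT, hTg⟩ := exists_isSymmetric_meanZero hM hd
  have hev : ∀ μ, Module.End.HasEigenvalue T μ → |μ| ≤ ρ := by
    intro μ hμ
    obtain ⟨f, hf⟩ := hμ.exists_hasEigenvector
    refine h μ (fun v => f.1 v) (fun h0 => hf.2 (Subtype.ext ?_)) f.2 ?_
    · ext v
      exact congrFun h0 v
    · funext v
      have := hTg f v
      rw [hf.apply_eq_smul] at this
      exact this.symm
  let x : meanZero V := ⟨WithLp.toLp 2 g, hg⟩
  constructor
  · have h1 := LinearMap.IsSymmetric.norm_sq_apply_le hT hev x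
    have h2 : ‖T x‖ ^ 2 = ∑ v, (M.mulVec g v) ^ 2 := by
      rw [Submodule.coe_norm, EuclideanSpace.norm_sq_eq]
      refine Finset.sum_congr rfl fun v _ => ?_
      rw [hTg x v, Real.norm_eq_abs, sq_abs]
    have h3 : ‖x‖ ^ 2 = ∑ v, g v ^ 2 := by
      rw [Submodule.coe_norm, EuclideanSpace.norm_sq_eq]
      refine Finset.sum_congr rfl fun v _ => ?_
      rw [Real.norm_eq_abs, sq_abs]
    rwa [h2, h3] at h1
  · intro hg0
    have hx : x ≠ 0 := fun h0 => hg0 (by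
      funext v
      exact congrArg (fun y : meanZero V => y.1 v) h0)
    have : Nontrivial (meanZero V) := ⟨x, 0, hx⟩
    have hpos : 0 < Module.finrank ℝ (meanZero V) := Module.finrank_pos
    exact (abs_nonneg _).trans (hev _ (hT.hasEigenvalue_eigenvalues rfl ⟨0, hpos⟩))

end Spectral

/-! ### The adjacency operator of the Cayley graph -/

variable {t : ℕ} {S : Finset (F2 t)}

theorem cayley_adj_iff (h0 : 0 ∉ S) (y w : F2 t) :
    (SimpleGraph.addCayley (S : Set (F2 t))).Adj y w ↔ y + w ∈ S := by
  have hneg : -y = y := neg_eq_of_add_eq_zero_left (F2.add_self y)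
  have hneg' : -w = w := neg_eq_of_add_eq_zero_left (F2.add_self w)
  rw [SimpleGraph.addCayley_adj, hneg, hneg', add_comm w y, or_self, Finset.mem_coe]
  constructor
  · exact fun h => h.2
  · refine fun h => ⟨?_, h⟩
    rintro rfl
    rw [F2.add_self] at h
    exact h0 h

open Classical in
theorem cayley_mulVec (h0 : 0 ∉ S) (g : F2 t → ℝ) (y : F2 t) :
    ((SimpleGraph.addCayley (S : Set (F2 t))).adjMatrix ℝ).mulVec g y = ∑ a : S, g (y + a) := by
  rw [Matrix.mulVec, dotProduct, Finset.sum_coe_sort S fun a => g (y + a),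
    ← Equiv.sum_comp (Equiv.addLeft y), ← Finset.sum_filter_add_sum_filter_not Finset.univ (· ∈ S)]
  simp only [SimpleGraph.adjMatrix_apply, cayley_adj_iff h0, Equiv.coe_addLeft]
  have h1 : ∀ a : F2 t, y + (y + a) = a := fun a => by
    rw [← add_assoc, F2.add_self, zero_add]
  simp only [h1]
  rw [Finset.sum_eq_zero (s := Finset.univ.filter fun a => a ∉ S), add_zero]
  · rw [Finset.filter_mem_eq_inter, Finset.univ_inter]
    exact Finset.sum_congr rfl fun a ha => by simp [ha]
  · intro a ha
    simp [(Finset.mem_filter.mp ha).2]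

open Classical in
theorem cayley_expander (h0 : 0 ∉ S) {ε : ℝ}
    (hG : (SimpleGraph.addCayley (S : Set (F2 t))).IsExpander ε) {g : F2 t → ℝ}
    (hg : ∑ y, g y = 0) :
    ∑ y, (∑ a : S, g (y + a)) ^ 2 ≤ ((1 - ε) * S.card) ^ 2 * ∑ y, g y ^ 2 ∧
      (g ≠ 0 → 0 ≤ (1 - ε) * S.card) := by
  obtain ⟨d, hd, hμ⟩ := hG
  have hrow : ∀ y, ∑ w, (SimpleGraph.addCayley (S : Set (F2 t))).adjMatrix ℝ y w = S.card := by
    intro y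
    have := cayley_mulVec h0 (fun _ => (1 : ℝ)) y
    simpa [Matrix.mulVec, dotProduct] using this
  have hdS : (d : ℝ) = S.card := by
    rw [← hrow 0, ← hd 0]
    simp [SimpleGraph.adjMatrix_apply, ← SimpleGraph.card_neighborFinset_eq_degree,
      SimpleGraph.neighborFinset_eq_filter]
    congr
  have := sum_sq_mulVec_le (SimpleGraph.isSymm_adjMatrix _) hrow
    (ρ := (1 - ε) * S.card) (fun μ f hf hf0 hfμ => hdS ▸ hμ μ ⟨f, hf, hf0, by convert hfμ⟩) hg
  simpa only [cayley_mulVec h0] using this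

theorem sum_sq_sub_add_eq (g : F2 t → ℝ) :
    ∑ a : S, ∑ b : S, ∑ y, (g (y + (a + b : F2 t)) - g y) ^ 2 =
      2 * S.card ^ 2 * ∑ y, g y ^ 2 - 2 * ∑ y, (∑ a : S, g (y + a)) ^ 2 := by
  have h1 : ∑ y, (∑ a : S, g (y + a)) ^ 2 =
      ∑ a : S, ∑ b : S, ∑ y, g (y + (a + b : F2 t)) * g y := by
    simp only [sq, Finset.sum_mul_sum]
    rw [Finset.sum_comm]
    refine Finset.sum_congr rfl fun a _ => ?_
    rw [Finset.sum_comm]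
    refine Finset.sum_congr rfl fun b _ => ?_
    rw [← Equiv.sum_comp (Equiv.addRight (b : F2 t))]
    refine Finset.sum_congr rfl fun y _ => ?_
    simp only [Equiv.coe_addRight, F2.add_add_cancel]
    congr 2
    abel
  have h2 : ∀ a b : S, ∑ y, (g (y + (a + b : F2 t)) - g y) ^ 2 =
      2 * ∑ y, g y ^ 2 - 2 * ∑ y, g (y + (a + b : F2 t)) * g y := by
    intro a b
    have h3 : ∑ y, g (y + (a + b : F2 t)) ^ 2 = ∑ y, g y ^ 2 :=
      Equiv.sum_comp (Equiv.addRight (a + b : F2 t)) fun y => g y ^ 2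
    calc _ = ∑ y, (g (y + (a + b : F2 t)) ^ 2 + g y ^ 2 - 2 * (g (y + (a + b : F2 t)) * g y)) :=
          Finset.sum_congr rfl fun y _ => by ring
      _ = _ := by
        rw [Finset.sum_sub_distrib, Finset.sum_add_distrib, h3, ← Finset.mul_sum]
        ring
  simp only [h2, Finset.sum_sub_distrib, Finset.sum_const, ← Finset.mul_sum, h1]
  simp only [Finset.card_univ, Fintype.card_coe, nsmul_eq_mul]
  ring

/-- The two-step walk has gap `1 - (1 - ε)² = ε + ε(1 - ε) ≥ ε`. Two steps are taken to match
`shift`. -/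
theorem cayley_poincare (h0 : 0 ∉ S) {ε : ℝ} (hε : 0 ≤ ε) (hε1 : ε ≤ 1)
    (hG : (SimpleGraph.addCayley (S : Set (F2 t))).IsExpander ε) {g : F2 t → ℝ}
    (hg : ∑ y, g y = 0) :
    2 * ε * S.card ^ 2 * ∑ y, g y ^ 2 ≤
      ∑ a : S, ∑ b : S, ∑ y, (g (y + (a + b : F2 t)) - g y) ^ 2 := by
  rw [sum_sq_sub_add_eq]
  have h1 := (cayley_expander h0 hG hg).1
  have h2 : 0 ≤ (S.card : ℝ) ^ 2 * ∑ y, g y ^ 2 :=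
    mul_nonneg (sq_nonneg _) (Finset.sum_nonneg fun _ _ => sq_nonneg _)
  have h3 : 0 ≤ ε * (1 - ε) * ((S.card : ℝ) ^ 2 * ∑ y, g y ^ 2) :=
    mul_nonneg (mul_nonneg hε (by linarith)) h2
  nlinarith

theorem cayley_eps_le_one (h0 : 0 ∉ S) (hS : S.Nonempty) {ε : ℝ}
    (hG : (SimpleGraph.addCayley (S : Set (F2 t))).IsExpander ε) : ε ≤ 1 := by
  classical
  obtain ⟨s, hs⟩ := hS
  have hs0 : s ≠ 0 := fun h => h0 (h ▸ hs)
  have h := (cayley_expander h0 hG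
    (g := fun y => (if y = s then 1 else 0) - if y = 0 then 1 else 0) (by simp)).2 (by
      intro h
      have := congrFun h s
      simp [hs0] at this)
  have hpos : (0 : ℝ) < S.card := by exact_mod_cast Finset.card_pos.mpr ⟨s, hs⟩
  have := nonneg_of_mul_nonneg_left h hpos
  linarith

/-! ### From costs to variance -/

theorem sum_sq_sub_sum_sq {X : Type*} [Fintype X] (m : X → ℝ) (hm : ∑ x, m x = 0) :
    ∑ x, ∑ x', (m x' - m x) ^ 2 = 2 * Fintype.card X * ∑ x, m x ^ 2 := by
  have h : ∀ x, ∑ x', (m x' - m x) ^ 2 = ∑ x', m x' ^ 2 + Fintype.card X * m x ^ 2 := by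
    intro x
    calc _ = ∑ x', (m x' ^ 2 + m x ^ 2 - 2 * m x * m x') :=
          Finset.sum_congr rfl fun _ _ => by ring
      _ = _ := by
        rw [Finset.sum_sub_distrib, Finset.sum_add_distrib, ← Finset.mul_sum, hm]
        simp
  simp only [h, Finset.sum_add_distrib, ← Finset.mul_sum, Finset.sum_const, Finset.card_univ,
    nsmul_eq_mul]
  ring

/-- The average of `F` over the base points. -/
noncomputable def avg (F : State S → ℝ) (ρ : Equiv.Perm S) : ℝ :=
  (∑ y, F (y, ρ)) / Fintype.card (F2 t)

theorem card_F2_pos : (0 : ℝ) < Fintype.card (F2 t) := by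
  exact_mod_cast Fintype.card_pos

theorem card_mul_avg (F : State S → ℝ) (ρ : Equiv.Perm S) :
    Fintype.card (F2 t) * avg F ρ = ∑ y, F (y, ρ) :=
  mul_div_cancel₀ _ card_F2_pos.ne'

theorem sum_sub_avg (F : State S → ℝ) (ρ : Equiv.Perm S) : ∑ y, (F (y, ρ) - avg F ρ) = 0 := by
  rw [Finset.sum_sub_distrib, ← card_mul_avg]
  simp

theorem sum_sq_eq_avg (F : State S → ℝ) :
    ∑ z, F z ^ 2 = ∑ ρ, ∑ y, (F (y, ρ) - avg F ρ) ^ 2 +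
      Fintype.card (F2 t) * ∑ ρ, avg F ρ ^ 2 := by
  rw [Fintype.sum_prod_type, Finset.sum_comm, Finset.mul_sum, ← Finset.sum_add_distrib]
  refine Finset.sum_congr rfl fun ρ _ => ?_
  have h : ∀ y, F (y, ρ) ^ 2 = (F (y, ρ) - avg F ρ) ^ 2 + 2 * avg F ρ * (F (y, ρ) - avg F ρ) +
      avg F ρ ^ 2 := fun y => by ring
  simp only [h, Finset.sum_add_distrib, ← Finset.mul_sum, sum_sub_avg]
  simp

/-- For each labelling `ρ`, reindexing the Poincaré inequality by `ρ` turns its translations into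
`shift a b`; summing over `ρ` gives squared costs. -/
theorem eps_sum_sq_sub_avg_le (h0 : 0 ∉ S) (hS : S.Nonempty) {ε : ℝ} (hε : 0 ≤ ε) (hε1 : ε ≤ 1)
    (hG : (SimpleGraph.addCayley (S : Set (F2 t))).IsExpander ε) {F : State S → ℝ} {L : ℝ}
    (hL : ∀ a b, cost F (shift a b) ≤ L) :
    2 * ε * ∑ ρ, ∑ y, (F (y, ρ) - avg F ρ) ^ 2 ≤ L ^ 2 := by
  have hpos : (0 : ℝ) < (S.card : ℝ) ^ 2 := by
    have : (0 : ℝ) < S.card := by exact_mod_cast Finset.card_pos.mpr hS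
    positivity
  have h1 : ∀ ρ : Equiv.Perm S, 2 * ε * S.card ^ 2 * ∑ y, (F (y, ρ) - avg F ρ) ^ 2 ≤
      ∑ a : S, ∑ b : S, ∑ y, (F (y + (ρ a + ρ b : F2 t), ρ) - F (y, ρ)) ^ 2 := by
    intro ρ
    have h2 := cayley_poincare h0 hε hε1 hG (sum_sub_avg F ρ)
    rw [← Equiv.sum_comp ρ] at h2
    simp only [sub_sub_sub_cancel_right] at h2
    refine h2.trans (le_of_eq (Finset.sum_congr rfl fun a _ => ?_))
    exact (Equiv.sum_comp ρ fun b : S => ∑ y, (F (y + (ρ a + b : F2 t), ρ) - F (y, ρ)) ^ 2).symm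
  have h3 : ∀ a b : S, ∑ ρ : Equiv.Perm S, ∑ y, (F (y + (ρ a + ρ b : F2 t), ρ) - F (y, ρ)) ^ 2 ≤
      L ^ 2 := by
    intro a b
    have h4 : cost F (shift a b) ^ 2 ≤ L ^ 2 := pow_le_pow_left₀ (cost_nonneg _ _) (hL a b) 2
    rw [cost, l2_sq, Fintype.sum_prod_type, Finset.sum_comm] at h4
    exact h4
  have h5 : 2 * ε * S.card ^ 2 * ∑ ρ, ∑ y, (F (y, ρ) - avg F ρ) ^ 2 ≤ S.card ^ 2 * L ^ 2 := by
    rw [Finset.mul_sum]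
    refine (Finset.sum_le_sum fun ρ _ => h1 ρ).trans ?_
    rw [Finset.sum_comm]
    calc _ ≤ ∑ a : S, ∑ b : S, L ^ 2 := by
          refine Finset.sum_le_sum fun a _ => ?_
          rw [Finset.sum_comm]
          exact Finset.sum_le_sum fun b _ => h3 a b
      _ = _ := by
        simp
        ring
  refine le_of_mul_le_mul_left ?_ hpos
  linarith

/-- The variance of `avg F` is half its mean squared change under `ρ ↦ ρ * κ`, which Cauchy–Schwarz
bounds by squared costs. -/
theorem sum_sq_avg_le {F : State S → ℝ} {L : ℝ} (hF : ∑ z, F z = 0)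
    (hL : ∀ κ, cost F (relabel κ) ≤ L) :
    2 * (Fintype.card (F2 t) * ∑ ρ, avg F ρ ^ 2) ≤ L ^ 2 := by
  have hpos : (0 : ℝ) < Fintype.card (Equiv.Perm S) := by exact_mod_cast Fintype.card_pos
  have hm : ∑ ρ, avg F ρ = 0 := by
    simp only [avg, ← Finset.sum_div]
    rw [Finset.sum_comm, ← Fintype.sum_prod_type, hF, zero_div]
  have h1 := sum_sq_sub_sum_sq (avg F) hm
  have h2 : ∀ ρ ρ' : Equiv.Perm S, Fintype.card (F2 t) * (avg F ρ' - avg F ρ) ^ 2 ≤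
      ∑ y, (F (y, ρ') - F (y, ρ)) ^ 2 := by
    intro ρ ρ'
    have h3 := sq_sum_le_card_mul_sum_sq (s := Finset.univ) (f := fun y => F (y, ρ') - F (y, ρ))
    rw [Finset.sum_sub_distrib, ← card_mul_avg, ← card_mul_avg, Finset.card_univ] at h3
    refine le_of_mul_le_mul_left ?_ (card_F2_pos (t := t))
    linarith
  have h4 : Fintype.card (F2 t) * ∑ ρ, ∑ ρ', (avg F ρ' - avg F ρ) ^ 2 ≤
      Fintype.card (Equiv.Perm S) * L ^ 2 := by
    have h5 : ∀ ρ : Equiv.Perm S, ∑ ρ', (avg F ρ' - avg F ρ) ^ 2 =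
        ∑ κ, (avg F (ρ * κ) - avg F ρ) ^ 2 := fun ρ =>
      (Equiv.sum_comp (Equiv.mulLeft ρ) fun ρ' => (avg F ρ' - avg F ρ) ^ 2).symm
    simp only [h5]
    rw [Finset.sum_comm, Finset.mul_sum]
    calc _ ≤ ∑ κ : Equiv.Perm S, L ^ 2 := by
          refine Finset.sum_le_sum fun κ _ => ?_
          have h6 : cost F (relabel κ) ^ 2 ≤ L ^ 2 := pow_le_pow_left₀ (cost_nonneg _ _) (hL κ) 2
          rw [cost, l2_sq, Fintype.sum_prod_type, Finset.sum_comm] at h6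
          refine le_trans ?_ h6
          rw [Finset.mul_sum]
          exact Finset.sum_le_sum fun ρ _ => h2 ρ (ρ * κ)
      _ = _ := by
        rw [Finset.sum_const, Finset.card_univ, nsmul_eq_mul]
  rw [h1] at h4
  refine le_of_mul_le_mul_left ?_ hpos
  linarith

/-- If all relabellings and shifts have small cost, then `F` has small variance. -/
theorem eps_sum_sq_le (h0 : 0 ∉ S) (hS : S.Nonempty) {ε : ℝ} (hε : 0 ≤ ε)
    (hG : (SimpleGraph.addCayley (S : Set (F2 t))).IsExpander ε) {F : State S → ℝ} {L : ℝ}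
    (hF : ∑ z, F z = 0) (hL : ∀ κ, cost F (relabel κ) ≤ L)
    (hL' : ∀ a b, cost F (shift a b) ≤ L) : ε * ∑ z, F z ^ 2 ≤ L ^ 2 := by
  have hε1 := cayley_eps_le_one h0 hS hG
  have h1 := eps_sum_sq_sub_avg_le h0 hS hε hε1 hG hL'
  have h2 := sum_sq_avg_le hF hL
  rw [sum_sq_eq_avg, mul_add]
  have h3 : 0 ≤ Fintype.card (F2 t) * ∑ ρ, avg F ρ ^ 2 := by positivity
  nlinarith

end SumHypergraph

namespace SumHypergraph

variable {r t : ℕ} {S : Finset (F2 t)} [NeZero r] {ι : Cut r ↪ S}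

/-! ### The eigenvalues of the walk graph -/

theorem DistinctSums.zero_notMem {n : ℕ} (hS : DistinctSums S n) (hn : 1 ≤ n) : 0 ∉ S := by
  intro h0
  have := hS {0} ∅ (by simpa using h0) (by simp) (by simpa using hn) (by simp) (by simp)
  simp at this

/-- For `k ≤ r - 2`, add three different points to a `(k-1)`-set; for `k = r - 1`, omit three
different points. -/
theorem exists_three_neighbours {k : ℕ} (hr : 3 ≤ r) (hk : 1 ≤ k) (hkr : k ≤ r - 1) :
    ∃ A B C : Finset (Fin r), (A.card = k ∧ B.card = k ∧ C.card = k) ∧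
      (A ∩ B).card + 1 = k ∧ (A ∩ C).card + 1 = k ∧ (B ∩ C).card + 1 = k := by
  obtain ⟨E, -, hE⟩ := Finset.exists_subset_card_eq (s := (Finset.univ : Finset (Fin r)))
    (n := k - 1) (by rw [Finset.card_univ, Fintype.card_fin]; omega)
  have hEc : Eᶜ.card = r - (k - 1) := by rw [Finset.card_compl, Fintype.card_fin, hE]
  by_cases h : 2 < Eᶜ.card
  · obtain ⟨a, ha, b, hb, c, hc, hab, hac, hbc⟩ := Finset.two_lt_card.mp h
    rw [Finset.mem_compl] at ha hb hc
    have key : ∀ x y, x ∉ E → y ∉ E → x ≠ y → insert x E ∩ insert y E = E := by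
      intro x y hx hy hxy
      ext j
      simp only [Finset.mem_inter, Finset.mem_insert]
      constructor
      · rintro ⟨rfl | h1, rfl | h2⟩
        · exact absurd rfl hxy
        all_goals assumption
      · exact fun h => ⟨Or.inr h, Or.inr h⟩
    refine ⟨insert a E, insert b E, insert c E, ⟨?_, ?_, ?_⟩, ?_, ?_, ?_⟩
    · rw [Finset.card_insert_of_notMem ha]; omega
    · rw [Finset.card_insert_of_notMem hb]; omega
    · rw [Finset.card_insert_of_notMem hc]; omega
    · rw [key a b ha hb hab]; omega
    · rw [key a c ha hc hac]; omega
    · rw [key b c hb hc hbc]; omega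
  · have hkr' : k + 1 = r := by omega
    have key1 : ∀ x : Fin r, (Finset.univ.erase x).card = k := fun x => by
      rw [Finset.card_erase_of_mem (Finset.mem_univ x), Finset.card_univ, Fintype.card_fin]
      omega
    have key2 : ∀ x y : Fin r, x ≠ y →
        (Finset.univ.erase x ∩ Finset.univ.erase y).card + 1 = k := by
      intro x y hxy
      have : Finset.univ.erase x ∩ Finset.univ.erase y = (Finset.univ.erase x).erase y := by
        ext j
        simp [and_comm]
      rw [this, Finset.card_erase_of_mem (by simpa using hxy.symm), key1]
      omega
    refine ⟨Finset.univ.erase ⟨0, by omega⟩, Finset.univ.erase ⟨1, by omega⟩,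
      Finset.univ.erase ⟨2, by omega⟩, ⟨key1 _, key1 _, key1 _⟩, key2 _ _ ?_, key2 _ _ ?_,
      key2 _ _ ?_⟩ <;> simp

theorem sum_kEdge_pair_eq (hS : DistinctSums S (2 ^ r)) (ι : Cut r ↪ S) {k : ℕ}
    {A B A' B' : Finset (Fin r)} (hA : A.card = k) (hB : B.card = k) (hA' : A'.card = k)
    (hB' : B'.card = k) (h : (A ∩ B).card = (A' ∩ B').card)
    (G : (H r t S).KEdge k → (H r t S).KEdge k → ℝ) :
    ∑ z : State S, G (kEdge hS ι A hA z) (kEdge hS ι B hB z) =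
      ∑ z : State S, G (kEdge hS ι A' hA' z) (kEdge hS ι B' hB' z) := by
  obtain ⟨σ, hσA, hσB⟩ := exists_perm_image_eq (hA.trans hA'.symm) (hB.trans hB'.symm) h
  rw [← (permState_bijective (ι := ι) σ).sum_comp]
  refine Finset.sum_congr rfl fun z _ => ?_
  have h1 : kEdge hS ι A hA (permState ι σ z) = kEdge hS ι A' hA' z :=
    (kEdge_eq_iff hS hA).mpr (by rw [image_pt_permState, hσA]; rfl)
  have h2 : kEdge hS ι B hB (permState ι σ z) = kEdge hS ι B' hB' z :=
    (kEdge_eq_iff hS hB).mpr (by rw [image_pt_permState, hσB]; rfl)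
  rw [h1, h2]

theorem dependsOnPt_kEdge (hS : DistinctSums S (2 ^ r)) {k : ℕ} {A : Finset (Fin r)}
    (hA : A.card = k) (f : (H r t S).KEdge k → ℝ) :
    DependsOnPt ι fun z => f (kEdge hS ι A hA z) := by
  intro z w h
  have : kEdge hS ι A hA z = kEdge hS ι A hA w :=
    (kEdge_eq_iff hS hA).mpr (by rw [h]; rfl)
  simp only [this]

/-- If `i ∈ A`, exchange it for some `b ∉ A`. The new function ignores point `i`, and by symmetry
its distance to the old one is that between the functions of `A` and `B`. -/
theorem pointMoveBound_kEdge (hS : DistinctSums S (2 ^ r)) (ι : Cut r ↪ S) {k : ℕ}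
    (hkr : k < r) {A B : Finset (Fin r)} (hA : A.card = k) (hB : B.card = k)
    (hAB : (A ∩ B).card + 1 = k) (f : (H r t S).KEdge k → ℝ) :
    PointMoveBound ι (fun z => f (kEdge hS ι A hA z))
      (2 * l2 fun z : State S => f (kEdge hS ι A hA z) - f (kEdge hS ι B hB z)) := by
  intro i φ hφ hpt
  have inv : ∀ (C : Finset (Fin r)) (hC : C.card = k), i ∉ C →
      ∀ z, f (kEdge hS ι C hC (φ z)) = f (kEdge hS ι C hC z) := by
    intro C hC hi z
    congr 1
    refine (kEdge_eq_iff hS hC).mpr (Finset.image_congr fun j hj => hpt z j ?_)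
    rintro rfl
    exact hi hj
  by_cases hi : i ∈ A
  · obtain ⟨b, hb⟩ : Aᶜ.Nonempty := by
      rw [← Finset.card_pos, Finset.card_compl, Fintype.card_fin]
      omega
    rw [Finset.mem_compl] at hb
    have hbi : b ≠ i := fun h => hb (h ▸ hi)
    have hC : (insert b (A.erase i)).card = k := by
      rw [Finset.card_insert_of_notMem fun h => hb (Finset.mem_of_mem_erase h),
        Finset.card_erase_add_one hi, hA]
    have hAC : A ∩ insert b (A.erase i) = A.erase i := by
      rw [Finset.inter_insert_of_notMem hb, Finset.inter_eq_right]
      exact Finset.erase_subset i A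
    refine cost_le_of_l2_sub_le (G := fun z => f (kEdge hS ι (insert b (A.erase i)) hC z)) hφ
      (le_of_eq ?_)
      (inv (insert b (A.erase i)) hC (by simp [hbi.symm]))
    simp only [l2]
    congr 1
    refine sum_kEdge_pair_eq hS ι hA hC hA hB ?_ fun a c => (f a - f c) ^ 2
    have := Finset.card_erase_add_one hi
    rw [hAC]
    omega
  · rw [cost_eq_zero (inv A hA hi)]
    exact mul_nonneg zero_le_two (l2_nonneg _)

open Classical in
theorem walkGraph_isExpander (hr : 3 ≤ r) (hcard : 2 ^ r < S.card)
    (hS : DistinctSums S (2 ^ r)) {ε : ℝ} (hε : 0 ≤ ε)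
    (hG : (SimpleGraph.addCayley (S : Set (F2 t))).IsExpander ε) {k : ℕ} (hk : 1 ≤ k)
    (hkr : k ≤ r - 1) :
    ((H r t S).walkGraph k).IsExpander (1 / (2 * (64 * r * 2 ^ r) ^ 2) * ε) := by
  have h0 : 0 ∉ S := hS.zero_notMem Nat.one_le_two_pow
  have hne : S.Nonempty := Finset.card_pos.mp (hcard.trans_le' (Nat.zero_le _))
  have hr1 : 1 < r := by omega
  have hrR : (1 : ℝ) ≤ r := by exact_mod_cast hr1.le
  have h2r : (1 : ℝ) ≤ 2 ^ r := one_le_pow₀ (by norm_num)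
  obtain ⟨ι⟩ : Nonempty (Cut r ↪ S) := by
    apply Function.Embedding.nonempty_of_card_le
    rw [Fintype.card_coe]
    exact Cut.card_le.trans hcard.le
  obtain ⟨A, B, C, ⟨hA, hB, hC⟩, hAB, hAC, hBC⟩ := exists_three_neighbours hr hk hkr
  obtain ⟨d, N, hd, hN, hdeg, hone, htwo⟩ := exists_degree hS hk hA hB hAB ι
  have hdR : (0 : ℝ) < d := by exact_mod_cast hd
  have hNR : (0 : ℝ) < N := by exact_mod_cast hN
  refine ⟨d, fun a => ?_, ?_⟩
  · rw [← hdeg a, ← SimpleGraph.card_neighborFinset_eq_degree,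
      SimpleGraph.neighborFinset_eq_filter]
  rintro μ ⟨f, hf, hf0, hfμ⟩
  set Q : ℝ := ∑ a, f a ^ 2 with hQ
  have hQpos : 0 < Q := by
    obtain ⟨a, ha⟩ := Function.ne_iff.mp hf
    exact Finset.sum_pos' (fun _ _ => sq_nonneg _) ⟨a, Finset.mem_univ a, sq_pos_of_ne_zero ha⟩
  let F : ∀ X : Finset (Fin r), X.card = k → State S → ℝ := fun X hX z => f (kEdge hS ι X hX z)
  have hsq : ∀ X (hX : X.card = k), ∑ z, F X hX z ^ 2 = N * d * Q := by
    intro X hX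
    rw [← hone fun a => f a ^ 2]
    exact sum_kEdge_pair_eq hS ι hX hX hA hA (by rw [Finset.inter_self, Finset.inter_self, hA, hX])
      fun a _ => f a ^ 2
  have hmul : ∀ X Y (hX : X.card = k) (hY : Y.card = k), (X ∩ Y).card + 1 = k →
      ∑ z, F X hX z * F Y hY z = N * μ * Q := by
    intro X Y hX hY hXY
    have h1 := sum_kEdge_pair_eq hS ι hX hY hA hB (by omega) fun a b => f a * f b
    refine h1.trans ((htwo fun a b => f a * f b).trans ?_)
    rw [mul_assoc (N : ℝ) μ, hQ, Finset.mul_sum _ _ μ]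
    refine congrArg ((N : ℝ) * ·) (Finset.sum_congr rfl fun a _ => ?_)
    rw [← Finset.mul_sum]
    have h2 := congrFun hfμ a
    rw [Pi.smul_apply, smul_eq_mul, Matrix.mulVec, dotProduct] at h2
    simp only [SimpleGraph.adjMatrix_apply, ite_mul, one_mul, zero_mul] at h2
    rw [Finset.sum_filter, h2]
    ring
  -- The square of the sum over a triangle is nonnegative: `3d + 6μ ≥ 0`.
  have hlower : -(d / 2 : ℝ) ≤ μ := by
    have h1 : 0 ≤ ∑ z, (F A hA z + F B hB z + F C hC z) ^ 2 :=
      Finset.sum_nonneg fun _ _ => sq_nonneg _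
    have h2 : ∑ z, (F A hA z + F B hB z + F C hC z) ^ 2 = 3 * (N * d * Q) + 6 * (N * μ * Q) := by
      calc _ = ∑ z, (F A hA z ^ 2 + F B hB z ^ 2 + F C hC z ^ 2 + 2 * (F A hA z * F B hB z) +
            2 * (F A hA z * F C hC z) + 2 * (F B hB z * F C hC z)) :=
            Finset.sum_congr rfl fun z _ => by ring
        _ = _ := by
          simp only [Finset.sum_add_distrib, ← Finset.mul_sum, hsq, hmul A B hA hB hAB,
            hmul A C hA hC hAC, hmul B C hB hC hBC]
          ring
    have h3 : 0 ≤ (N * Q) * (3 * d + 6 * μ) := by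
      rw [h2] at h1
      linarith
    have h4 := nonneg_of_mul_nonneg_right h3 (by positivity)
    linarith
  have hupper : ε * d ≤ (64 * r * 2 ^ r) ^ 2 * (2 * (d - μ)) := by
    set δ := l2 fun z => F A hA z - F B hB z with hδ
    have hδsq : δ ^ 2 = 2 * (N * d * Q) - 2 * (N * μ * Q) := by
      rw [hδ, l2_sq]
      calc _ = ∑ z, (F A hA z ^ 2 + F B hB z ^ 2 - 2 * (F A hA z * F B hB z)) :=
            Finset.sum_congr rfl fun z _ => by ring
        _ = _ := by
          simp only [Finset.sum_add_distrib, Finset.sum_sub_distrib, ← Finset.mul_sum, hsq,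
            hmul A B hA hB hAB]
          ring
    have hδ0 : 0 ≤ δ := l2_nonneg _
    have hF := dependsOnPt_kEdge (ι := ι) hS hA f
    have hD := pointMoveBound_kEdge hS ι (by omega) hA hB hAB f
    have hsum : ∑ z, F A hA z = 0 := by
      rw [show ∑ z, F A hA z = N * d * ∑ a, f a from hone f, hf0, mul_zero]
    -- A point move costs at most `D = 2δ`; the factor of `cost_shift_le` also covers relabellings.
    have h1 := eps_sum_sq_le (L := 32 * r * 2 ^ r * (2 * δ)) h0 hne hε hG hsum
      (fun κ => (cost_relabel_le hr1 hF hD κ).trans (by gcongr; norm_num))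
      (fun a b => cost_shift_le hr1 hF hD hcard a b)
    rw [hsq] at h1
    have h2 : (N * Q) * (ε * d) ≤ (N * Q) * ((64 * r * 2 ^ r) ^ 2 * (2 * (d - μ))) := by
      calc (N * Q) * (ε * d) = ε * (N * d * Q) := by ring
        _ ≤ (32 * r * 2 ^ r * (2 * δ)) ^ 2 := h1
        _ = (64 * r * 2 ^ r) ^ 2 * δ ^ 2 := by ring
        _ = _ := by rw [hδsq]; ring
    exact le_of_mul_le_mul_left h2 (by positivity)
  have hε1 := cayley_eps_le_one h0 hne hG
  have hK : (1 : ℝ) ≤ (64 * r * 2 ^ r) ^ 2 := by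
    apply one_le_pow₀
    nlinarith
  set K : ℝ := (64 * r * 2 ^ r) ^ 2
  -- With `ε ≤ 1`, this makes `-d/2` at least `-(1 - cε)d`, where `c = 1 / (2K)`.
  have hc : 1 / (2 * K) * ε ≤ 1 / 2 := by
    rw [div_mul_eq_mul_div, one_mul, div_le_div_iff₀ (by positivity) (by norm_num)]
    nlinarith
  rw [abs_le]
  constructor
  · nlinarith
  · have h1 : 1 / (2 * K) * ε * d ≤ d - μ := by
      rw [div_mul_eq_mul_div, one_mul, div_mul_eq_mul_div, div_le_iff₀ (by positivity)]
      linarith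
    linarith

end SumHypergraph

theorem theorem2 (r : ℕ) (hr : 3 ≤ r) :
    ∃ c : ℝ, 0 < c ∧
      ∀ (t : ℕ) (ε : ℝ) (S : Finset (SumHypergraph.F2 t)), 0 < ε →
        2 ^ (2 * r) ≤ S.card →
        SumHypergraph.DistinctSums S (2 ^ r) →
        (SimpleGraph.addCayley (S : Set (SumHypergraph.F2 t))).IsExpander ε →
        ∀ k : ℕ, 1 ≤ k → k ≤ r - 1 →
          ((SumHypergraph.H r t S).walkGraph k).IsExpander (c * ε) := by
  have : NeZero r := ⟨by omega⟩
  refine ⟨1 / (2 * (64 * r * 2 ^ r) ^ 2), by positivity, ?_⟩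
  intro t ε S hε hcard hS hG k hk hkr
  refine SumHypergraph.walkGraph_isExpander hr ?_ hS hε.le hG hk hkr
  exact (Nat.pow_lt_pow_right (by norm_num) (by omega)).trans_le hcard
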